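/- Let $1<p<\infty$ and let $E$ be a (real) Banach space that is a UMD space, with UMD constant $\beta_p(E)$: $\|\sum_{n=1}^N\epsilon_n d_n\|_{L^p(E)}\le\beta_p(E)\,\|\sum_{n=1}^N d_n\|_{L^p(E)}$ for all finite $E$-valued $L^p$-martingale difference sequences $(d_n)_{n=1}^N$ on probability spaces and all signs $\epsilon_n\in\{-1,1\}$. Let $\mathcal D$ be a dyadic system in $\mathbb R^d$: the standard one $\{2^{-k}([0,1)^d+m):k\in\mathbb Z,\ m\in\mathbb Z^d\}$, or, for some $\omega=(\omega_j)_{j\in\mathbb Z}\in(\{0,1\}^d)^{\mathbb Z}$, its translate in which each cube $I$ of side length $\ell(I)=2^{-k}$ is replaced by $I+\sum_{j>k}2^{-j}\omega_j$. For a locally integrable $f:\mathbb R^d\to E$ and $I,K\in\mathcal D$ put $\langle f\rangle_I=\frac1{|I|}\int_I f$, $$D_If=\sum_{I'\in\mathrm{child}(I)}\langle f\rangle_{I'}1_{I'}-\langle f\rangle_I1_I,\qquad D^i_Kf=\sum_{I\in\mathcal D,\ I\subseteq K,\ \ell(I)=2^{-i}\ell(K)}D_If,$$ where $\mathrm{child}(I)$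 is the set of the dyadic cubes $I'\subseteq I$ with $\ell(I')=\ell(I)/2$. For each $K\in\mathcal D$ let $a_K:\mathbb R^d\times\mathbb R^d\to\mathcal L(E)$ be such that $(x,x')\mapsto a_K(x,x')e$ is strongly measurable (up to null sets) on $K\times K$ for each $e\in E$, and put $$A_Kf(x)=\frac{1_K(x)}{|K|}\int_K a_K(x,x')f(x')\,dx'.$$ Assume that the family $\{a_K(x,x'):K\in\mathcal D,\ x,x'\in K\}$ is $R$-bounded with $R$-bound $\mathcal R_p(\{a\})$: for all $N$, all operators $T_1,\dots,T_N$ in the family and all $e_1,\dots,e_N\in E$, $$\Big(\mathbb E\Big|\sum_{n=1}^N\varepsilon_nT_ne_n\Big|_E^p\Big)^{1/p}\le\mathcal R_p(\{a\})\Big(\mathbb E\Big|\sum_{n=1}^N\varepsilon_ne_n\Big|_E^p\Big)^{1/p},$$ where $\varepsilon_1,\dots,\varepsilon_N$ are independent unbiased random signs. Then for all integers $i,j\ge0$ the operator-valued dyadic shift $$S^{ij}f=\sum_{K\in\mathcal D}D^j_KA_KD^i_Kf$$ is a well-defined bounded linear operator on $L^p(\mathbb R^d;E)$ (for each $f\in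 L^p(\mathbb R^d;E)$ the series converges unconditionally in $L^p(\mathbb R^d;E)$), and $$\|S^{ij}f\|_{L^p(\mathbb R^d;E)}\le 4\,(\max\{i,j\}+1)\,\mathcal R_p(\{a\})\,\beta_p(E)^2\,\|f\|_{L^p(\mathbb R^d;E)}\qquad\text{for all }f\in L^p(\mathbb R^d;E).$$ -/

import Mathlib

open MeasureTheory ProbabilityTheory Filter
open scoped ENNReal NNReal

noncomputable section

/-! ## R-boundedness -/

/-- `𝔼 ‖∑ ε_n e_n‖ ^ p`, the expectation being over independent unbiased random signs
`ε_1, …, ε_N`, that is, over the uniform distribution on `{-1, 1}^N`. -/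
def rademacherMoment {E : Type*} [NormedAddCommGroup E] (p : ℝ) {N : ℕ} (e : Fin N → E) : ℝ :=
  ((2 : ℝ) ^ N)⁻¹ * ∑ ε : Fin N → ℤˣ, ‖∑ n, ε n • e n‖ ^ p

/-- `C` is an `R`-bound, with exponent `p`, of the family `𝒯` of bounded operators. -/
def IsRBound {E F : Type*} [NormedAddCommGroup E] [NormedSpace ℝ E]
    [NormedAddCommGroup F] [NormedSpace ℝ F]
    (p : ℝ) (𝒯 : Set (E →L[ℝ] F)) (C : ℝ≥0) : Prop :=
  ∀ (N : ℕ) (T : Fin N → E →L[ℝ] F) (e : Fin N → E), (∀ n, T n ∈ 𝒯) →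
    rademacherMoment p (fun n => T n (e n)) ^ (1 / p) ≤ C * rademacherMoment p e ^ (1 / p)

/-! ## The UMD property -/

/-- `d` is an `L^p` martingale difference sequence with respect to the filtration `ℱ`
(the sequence of increments of the martingale `d 0`, `d 0 + d 1`, …). -/
structure IsMartingaleDifference {Ω E : Type*} [NormedAddCommGroup E] [NormedSpace ℝ E]
    [CompleteSpace E] {m : MeasurableSpace Ω} (d : ℕ → Ω → E) (ℱ : Filtration ℕ m)
    (p : ℝ≥0∞) (μ : Measure Ω) : Prop where
  stronglyMeasurable : ∀ n, StronglyMeasurable[ℱ n] (d n)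
  memLp : ∀ n, MemLp (d n) p μ
  condExp_eq_zero : ∀ n, μ[d (n + 1) | ℱ n] =ᵐ[μ] 0

/-- `β` is a UMD constant of `E` for the exponent `p`: the UMD inequality holds with the
constant `β` for all finite `E`-valued `L^p` martingale difference sequences, on all probability
spaces, and for all choices of signs. (`E` is a UMD space iff it has such a constant.) -/
def IsUMDConstant (E : Type*) [NormedAddCommGroup E] [NormedSpace ℝ E] [CompleteSpace E]
    (p : ℝ≥0∞) (β : ℝ≥0) : Prop :=
  ∀ (Ω : Type) (m : MeasurableSpace Ω) (μ : Measure Ω) (_ : IsProbabilityMeasure μ)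
    (ℱ : Filtration ℕ m) (d : ℕ → Ω → E), IsMartingaleDifference d ℱ p μ →
    ∀ (N : ℕ) (ε : ℕ → ℤˣ),
      eLpNorm (fun x => ∑ n ∈ Finset.range N, ε n • d n x) p μ ≤
        β * eLpNorm (fun x => ∑ n ∈ Finset.range N, d n x) p μ

/-! ## Dyadic cubes -/

/-- The dyadic cubes of `ℝ^d`: `(k, m)` stands for the standard dyadic cube
`2 ^ (-k) ([0, 1) ^ d + m)`, and for its translates below. -/
abbrev DyadicCube (d : ℕ) : Type := ℤ × (Fin d → ℤ)

/-- The parameters `ω ∈ ({0, 1} ^ d) ^ ℤ` of the translated dyadic systems. -/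
abbrev DyadicParam (d : ℕ) : Type := ℤ → Fin d → Fin 2

/-- The translation `∑_{j > k} 2 ^ (-j) ω_j` of the cubes of side length `2 ^ (-k)`,
with `j = k + 1 + n`. -/
def dyadicShiftVector {d : ℕ} (ω : DyadicParam d) (k : ℤ) (c : Fin d) : ℝ :=
  ∑' n : ℕ, (2 : ℝ) ^ (-(k + 1 + n)) * ((ω (k + 1 + n) c : ℕ) : ℝ)

/-- The cube with index `Q` in the dyadic system `𝒟^ω`; `ω = 0` is the standard system. -/
def dyadicCube {d : ℕ} (ω : DyadicParam d) (Q : DyadicCube d) : Set (Fin d → ℝ) :=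
  {x | ∀ c, (2 : ℝ) ^ (-Q.1) * Q.2 c + dyadicShiftVector ω Q.1 c ≤ x c ∧
    x c < (2 : ℝ) ^ (-Q.1) * (Q.2 c + 1) + dyadicShiftVector ω Q.1 c}

/-- The dyadic cubes `I ⊆ K` with `ℓ(I) = 2 ^ (-i) ℓ(K)`. -/
def dyadicDescendants {d : ℕ} (ω : DyadicParam d) (i : ℕ) (K : DyadicCube d) :
    Set (DyadicCube d) :=
  {I | I.1 = K.1 + i ∧ dyadicCube ω I ⊆ dyadicCube ω K}

/-! ## Dyadic shifts -/

section Shift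

variable {d : ℕ} {E : Type*} [NormedAddCommGroup E] [NormedSpace ℝ E]

/-- The function `⟨f⟩_I 1_I`. -/
def dyadicAverage (ω : DyadicParam d) (I : DyadicCube d) (f : (Fin d → ℝ) → E) :
    (Fin d → ℝ) → E :=
  (dyadicCube ω I).indicator fun _ => ⨍ y in dyadicCube ω I, f y

/-- The Haar projection `D_I f = ∑_{I' ∈ child(I)} ⟨f⟩_{I'} 1_{I'} - ⟨f⟩_I 1_I`. -/
def haarProjection (ω : DyadicParam d) (I : DyadicCube d) (f : (Fin d → ℝ) → E) :
    (Fin d → ℝ) → E := fun x =>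
  (∑ᶠ I' ∈ dyadicDescendants ω 1 I, dyadicAverage ω I' f x) - dyadicAverage ω I f x

/-- The shifted Haar projection `D^i_K f = ∑_{I ⊆ K, ℓ(I) = 2 ^ (-i) ℓ(K)} D_I f`. -/
def shiftedHaarProjection (ω : DyadicParam d) (i : ℕ) (K : DyadicCube d)
    (f : (Fin d → ℝ) → E) : (Fin d → ℝ) → E := fun x =>
  ∑ᶠ I ∈ dyadicDescendants ω i K, haarProjection ω I f x

/-- The averaging operator `A_K f(x) = 1_K(x) / |K| ∫_K a_K(x, x') f(x') dx'`. -/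
def averagingOperator (ω : DyadicParam d) (K : DyadicCube d)
    (aK : (Fin d → ℝ) → (Fin d → ℝ) → E →L[ℝ] E) (f : (Fin d → ℝ) → E) : (Fin d → ℝ) → E :=
  (dyadicCube ω K).indicator fun x => ⨍ x' in dyadicCube ω K, aK x x' (f x')

/-- The summand `D^j_K A_K D^i_K f` of the operator-valued dyadic shift with kernels `a`. -/
def dyadicShiftTerm (ω : DyadicParam d)
    (a : DyadicCube d → (Fin d → ℝ) → (Fin d → ℝ) → E →L[ℝ] E) (i j : ℕ)
    (f : (Fin d → ℝ) → E) (K : DyadicCube d) : (Fin d → ℝ) → E :=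
  shiftedHaarProjection ω j K (averagingOperator ω K (a K) (shiftedHaarProjection ω i K f))

/-- The family of operators `{a_K(x, x') : K ∈ 𝒟, x ∈ K, x' ∈ K}`. -/
def kernelFamily (ω : DyadicParam d)
    (a : DyadicCube d → (Fin d → ℝ) → (Fin d → ℝ) → E →L[ℝ] E) : Set (E →L[ℝ] E) :=
  {T | ∃ K, ∃ x ∈ dyadicCube ω K, ∃ x' ∈ dyadicCube ω K, a K x x' = T}

/-- `S` is the operator-valued dyadic shift `S^{ij} = ∑_K D^j_K A_K D^i_K` on `L^p(ℝ^d; E)`: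
for every `f`, the summands belong to `L^p(ℝ^d; E)` and their series converges
unconditionally to `S f` there. -/
def IsDyadicShift (ω : DyadicParam d)
    (a : DyadicCube d → (Fin d → ℝ) → (Fin d → ℝ) → E →L[ℝ] E) (i j : ℕ)
    (p : ℝ≥0∞) [Fact (1 ≤ p)]
    (S : Lp E p (volume : Measure (Fin d → ℝ)) → Lp E p (volume : Measure (Fin d → ℝ))) : Prop :=
  ∀ f : Lp E p (volume : Measure (Fin d → ℝ)), ∃ h : ∀ K, MemLp (dyadicShiftTerm ω a i j f K) p volume,
    HasSum (fun K => (h K).toLp) (S f)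

end Shift

end

/-! Put `s = max i j + 1` and call the cubes `s` generations below `K` its children. On `K` the
operator `D^i_K` is a difference of two dyadic conditional expectations, so `D^i_K f` and `D^j_K A_K
D^i_K f` are constant on these children and depend only on the averages of `f` over them. If the
generations of the cubes `K` are restricted to one residue class modulo `s`, the child averages form
a martingale on the paths of a homogeneous tree with `2 ^ (s * d)` branches. The shift then sends
the increment at each node to another increment at the same node (`dyadicShiftTerm_of_mem_child`).

The UMD property is used twice, as a decoupling. A martingale `∑ b_r(x, x_r)` is comparable with the
random sum `∑ ε_r b_r(x, y_r)`, where `y` is an independent copy of `x`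
(`IsUMDConstant.sum_rademacherMoment_le` and `IsUMDConstant.le_sum_rademacherMoment`). Each passage
costs a factor `β`. For frozen `x` the variables `y_r` are independent, so Jensen's inequality for
product kernels bounds the action on all nodes at once. The two differences of expectations cost `2`
each. The averaging operator costs `R`, because averages of the kernel stay in closed convex hulls,
to which `R`-bounds extend. This gives `4 R β ^ 2` for one residue class
(`IsUMDConstant.sum_norm_discreteShift_le`), and the triangle inequality over the `s` classes gives
the factor `max i j + 1`.

These bounds are uniform over finite sets of cubes, so the functions whose series converges
unconditionally form a closed subspace. It contains `e (1_Q - 2 ^ (-d) 1_Q')`, with `Q'` the parent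
of `Q`, since at most one summand is then nonzero. Iterating over parents puts `e 1_Q` in it,
because `2 ^ (-d n) 1_{Q^(n)}`, with `Q^(n)` the `n`-th ancestor of `Q`, tends to `0` in `L^p` for
`p > 1`. The functions `e 1_Q` span a dense subspace. -/

set_option linter.unusedSectionVars false

/-! ### The UMD inequality on finite uniform probability spaces -/

/-- The `σ`-algebra of the sets that are unions of classes of the relation `r`. -/
@[reducible]
def saturatedMeasurableSpace {Ω : Type*} (r : Ω → Ω → Prop) : MeasurableSpace Ω where
  MeasurableSet' s := ∀ ω ω', r ω ω' → (ω ∈ s ↔ ω' ∈ s)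
  measurableSet_empty := by simp
  measurableSet_compl s hs ω ω' h := not_congr (hs ω ω' h)
  measurableSet_iUnion s hs ω ω' h := by
    simp only [Set.mem_iUnion]
    exact exists_congr fun n => hs n ω ω' h

theorem measurableSet_saturated {Ω : Type*} {r : Ω → Ω → Prop} {s : Set Ω} :
    MeasurableSet[saturatedMeasurableSpace r] s ↔ ∀ ω ω', r ω ω' → (ω ∈ s ↔ ω' ∈ s) := Iff.rfl

theorem stronglyMeasurable_saturated {Ω E : Type*} [Finite Ω] [TopologicalSpace E]
    {r : Ω → Ω → Prop} {f : Ω → E} (hf : ∀ ω ω', r ω ω' → f ω = f ω') :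
    StronglyMeasurable[saturatedMeasurableSpace r] f :=
  @SimpleFunc.stronglyMeasurable Ω E (saturatedMeasurableSpace r) _
    (@SimpleFunc.mk Ω (saturatedMeasurableSpace r) E f
      (fun x ω ω' h => by simp [hf ω ω' h]) (Set.finite_range f))

/-- The uniform distribution on a finite type, all of whose subsets are measurable. -/
noncomputable def finiteUniform (Ω : Type*) [Fintype Ω] : @Measure Ω ⊤ :=
  (Fintype.card Ω : ℝ≥0∞)⁻¹ • @Measure.count Ω ⊤

section FiniteUniform

variable {Ω : Type*} [Fintype Ω]

theorem finiteUniform_singleton (ω : Ω) :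
    finiteUniform Ω {ω} = (Fintype.card Ω : ℝ≥0∞)⁻¹ := by
  let _ : MeasurableSpace Ω := ⊤
  simp [finiteUniform]

theorem isProbabilityMeasure_finiteUniform [Nonempty Ω] :
    @IsProbabilityMeasure Ω ⊤ (finiteUniform Ω) := by
  let _ : MeasurableSpace Ω := ⊤
  refine ⟨?_⟩
  have h0 : (Fintype.card Ω : ℝ≥0∞) ≠ 0 := by simp
  simp [finiteUniform, Measure.count_univ, ENNReal.inv_mul_cancel h0]

theorem eLpNorm_finiteUniform {E : Type*} [NormedAddCommGroup E] {p : ℝ≥0∞} (hp0 : p ≠ 0)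
    (hp : p ≠ ∞) (f : Ω → E) :
    @eLpNorm Ω E _ ⊤ f p (finiteUniform Ω) =
      ((∑ ω, ‖f ω‖ₑ ^ p.toReal) * (Fintype.card Ω : ℝ≥0∞)⁻¹) ^ (1 / p.toReal) := by
  let _ : MeasurableSpace Ω := ⊤
  rw [eLpNorm_eq_lintegral_rpow_enorm_toReal hp0 hp, lintegral_fintype, Finset.sum_mul]
  simp_rw [finiteUniform_singleton]

end FiniteUniform

section FiniteMartingale

variable {E : Type*} [NormedAddCommGroup E] [NormedSpace ℝ E] [CompleteSpace E]
  {Ω : Type} [Fintype Ω] [Nonempty Ω]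

/-- Testing against indicators of saturated sets is enough, and these are among the invariant
functions `h`. -/
theorem condExp_finiteUniform_eq_zero {r : Ω → Ω → Prop} {f : Ω → E}
    (hf : ∀ h : Ω → ℝ, (∀ ω ω', r ω ω' → h ω = h ω') → ∑ ω, h ω • f ω = 0) :
    (@condExp Ω E (saturatedMeasurableSpace r) ⊤ _ _ (finiteUniform Ω) f)
      =ᵐ[finiteUniform Ω] 0 := by
  let _ : MeasurableSpace Ω := ⊤
  have := isProbabilityMeasure_finiteUniform (Ω := Ω)
  have hint : ∀ g : Ω → E, Integrable g (finiteUniform Ω) := fun g => Integrable.of_finite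
  symm
  refine ae_eq_condExp_of_forall_setIntegral_eq (m := saturatedMeasurableSpace r) le_top
    (hint f) (fun s _ _ => (hint _).integrableOn) (fun s hs _ => ?_)
    (stronglyMeasurable_saturated fun _ _ _ => rfl).aestronglyMeasurable
  classical
  rw [← integral_indicator (μ := finiteUniform Ω) (f := f) (s := s) trivial, integral_fintype (hint _)]
  have h2 := hf (s.indicator 1) fun ω ω' h => by
    have := (measurableSet_saturated.1 hs) ω ω' h
    by_cases h' : ω ∈ s
    · simp [h', this.1 h']
    · simp [h', mt this.2 h']
  simp only [Measure.real, finiteUniform_singleton, ← Finset.smul_sum]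
  have h3 : ∑ ω, s.indicator f ω = 0 := by
    rw [← h2]
    refine Finset.sum_congr rfl fun ω _ => ?_
    by_cases h' : ω ∈ s <;> simp [h']
  simp [h3]

/-- The UMD inequality without measure theory: successively finer relations replace the filtration,
orthogonality to invariant functions replaces the vanishing conditional expectation, and the
normalization of the uniform measure cancels. -/
theorem IsUMDConstant.sum_norm_rpow_le {p : ℝ≥0∞} (hp0 : p ≠ 0) (hp : p ≠ ∞) {β : ℝ≥0}
    (hβ : IsUMDConstant E p β) {r : ℕ → Ω → Ω → Prop}
    (hr : ∀ n ω ω', r (n + 1) ω ω' → r n ω ω') {d : ℕ → Ω → E}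
    (hd : ∀ n ω ω', r n ω ω' → d n ω = d n ω')
    (hd0 : ∀ n (h : Ω → ℝ), (∀ ω ω', r n ω ω' → h ω = h ω') → ∑ ω, h ω • d (n + 1) ω = 0)
    (N : ℕ) (ε : ℕ → ℤˣ) :
    ∑ ω, ‖∑ n ∈ Finset.range N, ε n • d n ω‖ ^ p.toReal ≤
      (β : ℝ) ^ p.toReal * ∑ ω, ‖∑ n ∈ Finset.range N, d n ω‖ ^ p.toReal := by
  let _ : MeasurableSpace Ω := ⊤
  have hP := isProbabilityMeasure_finiteUniform (Ω := Ω)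
  have hq : 0 < p.toReal := ENNReal.toReal_pos hp0 hp
  let ℱ : Filtration ℕ (⊤ : MeasurableSpace Ω) :=
    { seq := fun n => saturatedMeasurableSpace (r n)
      mono' := monotone_nat_of_le_succ fun n s hs ω ω' h => hs ω ω' (hr n ω ω' h)
      le' := fun n => le_top }
  have key := hβ Ω ⊤ (finiteUniform Ω) hP ℱ d
    ⟨fun n => stronglyMeasurable_saturated (hd n), fun n => MemLp.of_discrete,
      fun n => condExp_finiteUniform_eq_zero (hd0 n)⟩ N ε
  rw [eLpNorm_finiteUniform hp0 hp, eLpNorm_finiteUniform hp0 hp] at key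
  have hc : (Fintype.card Ω : ℝ≥0∞) ≠ 0 := by simp
  have hc' : (Fintype.card Ω : ℝ≥0∞)⁻¹ ≠ 0 := by simp
  have hc'' : (Fintype.card Ω : ℝ≥0∞)⁻¹ ≠ ∞ := by simp
  have key2 := ENNReal.rpow_le_rpow key hq.le
  rw [ENNReal.mul_rpow_of_nonneg _ _ hq.le, ← ENNReal.rpow_mul, ← ENNReal.rpow_mul,
    one_div_mul_cancel hq.ne', ENNReal.rpow_one, ENNReal.rpow_one, ← mul_assoc,
    ENNReal.mul_le_mul_iff_left hc' hc''] at key2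
  have hfin : ∀ g : Ω → E, ∑ ω, ‖g ω‖ₑ ^ p.toReal = ENNReal.ofReal (∑ ω, ‖g ω‖ ^ p.toReal) := by
    intro g
    rw [ENNReal.ofReal_sum_of_nonneg fun _ _ => by positivity]
    refine Finset.sum_congr rfl fun ω _ => ?_
    rw [← ofReal_norm, ENNReal.ofReal_rpow_of_nonneg (norm_nonneg _) hq.le]
  rw [hfin, hfin, ← ENNReal.ofReal_coe_nnreal,
    ENNReal.ofReal_rpow_of_nonneg β.coe_nonneg hq.le, ← ENNReal.ofReal_mul (by positivity)] at key2
  exact (ENNReal.ofReal_le_ofReal_iff (by positivity)).1 key2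

end FiniteMartingale

/-! ### Rademacher moments: convexity, symmetry, contraction -/

section Rademacher

variable {E : Type*} [NormedAddCommGroup E] [NormedSpace ℝ E] {q : ℝ} {n : ℕ}

theorem convexOn_norm_rpow (hq : 1 ≤ q) : ConvexOn ℝ Set.univ fun v : E => ‖v‖ ^ q := by
  refine ⟨convex_univ, fun v _ w _ s t hs ht hst => ?_⟩
  calc ‖s • v + t • w‖ ^ q ≤ (s * ‖v‖ + t * ‖w‖) ^ q := by
        refine Real.rpow_le_rpow (norm_nonneg _) ((norm_add_le _ _).trans_eq ?_) (by linarith)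
        rw [norm_smul, norm_smul, Real.norm_of_nonneg hs, Real.norm_of_nonneg ht]
    _ ≤ s • ‖v‖ ^ q + t • ‖w‖ ^ q :=
        (convexOn_rpow hq).2 (norm_nonneg v) (norm_nonneg w) hs ht hst

theorem rademacherMoment_nonneg (e : Fin n → E) : 0 ≤ rademacherMoment q e := by
  unfold rademacherMoment; positivity

theorem units_smul_eq_real_smul (u : ℤˣ) (v : E) : u • v = ((u : ℤ) : ℝ) • v := by
  rw [Units.smul_def, Int.cast_smul_eq_zsmul]

/-- The source of the later inequalities between moments: the contraction principle, Jensen's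
inequality and the passage to convex hulls all follow from this convexity. -/
theorem convexOn_rademacherMoment (hq : 1 ≤ q) :
    ConvexOn ℝ Set.univ (rademacherMoment q : (Fin n → E) → ℝ) := by
  have h : ∀ ε : Fin n → ℤˣ,
      ConvexOn ℝ Set.univ fun e : Fin n → E => ‖∑ k, ε k • e k‖ ^ q := by
    intro ε
    refine ⟨convex_univ, fun v _ w _ s t hs ht hst => ?_⟩
    have := (convexOn_norm_rpow (E := E) hq).2 (Set.mem_univ (∑ k, ε k • v k))
      (Set.mem_univ (∑ k, ε k • w k)) hs ht hst
    refine le_of_eq_of_le ?_ this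
    simp only [Pi.add_apply, Pi.smul_apply, smul_add, Finset.sum_add_distrib, Finset.smul_sum,
      smul_comm s, smul_comm t]
  refine ⟨convex_univ, fun v _ w _ s t hs ht hst => ?_⟩
  unfold rademacherMoment
  rw [smul_eq_mul, smul_eq_mul, mul_left_comm s, mul_left_comm t, ← mul_add]
  refine mul_le_mul_of_nonneg_left ?_ (by positivity)
  rw [Finset.mul_sum, Finset.mul_sum, ← Finset.sum_add_distrib]
  exact Finset.sum_le_sum fun ε _ => (h ε).2 trivial trivial hs ht hst

theorem continuous_rademacherMoment (hq : 0 ≤ q) :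
    Continuous (rademacherMoment q : (Fin n → E) → ℝ) := by
  unfold rademacherMoment
  refine continuous_const.mul (continuous_finsetSum _ fun ε _ => ?_)
  refine Continuous.rpow_const ?_ fun _ => Or.inr hq
  refine (continuous_finsetSum _ fun k _ => ?_).norm
  simp only [units_smul_eq_real_smul]
  fun_prop

theorem rademacherMoment_units_smul (σ : Fin n → ℤˣ) (e : Fin n → E) :
    rademacherMoment q (fun k => σ k • e k) = rademacherMoment q e := by
  unfold rademacherMoment
  congr 1
  refine Fintype.sum_equiv (Equiv.mulRight σ) _ _ fun ε => ?_
  simp [mul_smul]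

theorem rademacherMoment_smul (c : ℝ) (e : Fin n → E) :
    rademacherMoment q (fun k => c • e k) = |c| ^ q * rademacherMoment q e := by
  unfold rademacherMoment
  rw [mul_left_comm]
  congr 1
  rw [Finset.mul_sum]
  refine Finset.sum_congr rfl fun ε _ => ?_
  have h : ∑ k : Fin n, ε k • c • e k = c • ∑ k : Fin n, ε k • e k := by
    rw [Finset.smul_sum]
    exact Finset.sum_congr rfl fun k _ => smul_comm _ _ _
  rw [h, norm_smul, Real.mul_rpow (norm_nonneg _) (norm_nonneg _), Real.norm_eq_abs]

/-- Convexity at the midpoint of `2v` and `-2w`. The `2 ^ q` is the price of each Haar projection in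
the final constant. -/
theorem rademacherMoment_sub_le (hq : 1 ≤ q) (v w : Fin n → E) :
    rademacherMoment q (fun k => v k - w k) ≤
      2 ^ q * ((rademacherMoment q v + rademacherMoment q w) / 2) := by
  have h := (convexOn_rademacherMoment hq).2 (Set.mem_univ fun k => (2 : ℝ) • v k)
    (Set.mem_univ fun k => (-2 : ℝ) • w k) (by norm_num : (0 : ℝ) ≤ 1 / 2)
    (by norm_num : (0 : ℝ) ≤ 1 / 2) (by norm_num)
  rw [rademacherMoment_smul, rademacherMoment_smul] at h
  have h2 : ((1 / 2 : ℝ) • (fun k => (2 : ℝ) • v k) + (1 / 2 : ℝ) • fun k => (-2 : ℝ) • w k)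
      = fun k => v k - w k := by
    ext k
    simp [smul_smul, sub_eq_add_neg]
  rw [h2] at h
  refine h.trans_eq ?_
  simp only [abs_neg, abs_two, smul_eq_mul]
  ring

/-- Kahane's contraction principle, for coefficients in `{0, 1}`. -/
theorem rademacherMoment_ite_le (hq : 1 ≤ q) (P : Fin n → Prop) [DecidablePred P]
    (e : Fin n → E) :
    rademacherMoment q (fun k => if P k then e k else 0) ≤ rademacherMoment q e := by
  -- The truncated sequence is the midpoint of `e` and of `e` with the signs flipped where `P`
  -- fails; sign changes do not affect the moment.
  have h := (convexOn_rademacherMoment hq).2 (Set.mem_univ e)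
    (Set.mem_univ fun k => (if P k then (1 : ℤˣ) else -1) • e k) (by norm_num : (0 : ℝ) ≤ 1 / 2)
    (by norm_num : (0 : ℝ) ≤ 1 / 2) (by norm_num)
  rw [rademacherMoment_units_smul (fun k => if P k then (1 : ℤˣ) else -1)] at h
  refine le_of_eq_of_le ?_ (h.trans_eq ?_)
  · congr 1
    ext k
    by_cases hk : P k
    · simp only [hk, if_true, Pi.add_apply, Pi.smul_apply, one_smul, ← add_smul]
      norm_num
    · simp [hk]
  · simp only [smul_eq_mul]; ring

end Rademacher

/-! ### Jensen's inequality for product kernels -/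

section ProductWeights

variable {E : Type*} [NormedAddCommGroup E] [NormedSpace ℝ E] {q : ℝ} {n : ℕ}
  {A : Type*} [Fintype A]

theorem sum_prod_weights (w : Fin n → A → ℝ) (hw : ∀ r, ∑ a, w r a = 1) :
    ∑ z : Fin n → A, ∏ r, w r (z r) = 1 := by
  classical
  rw [← Fintype.piFinset_univ, ← Finset.prod_univ_sum]
  simp [hw]

/-- The `r`-th marginal of a product probability is its `r`-th factor: inserting the indicator of `z
r = a` keeps the product form, and the other factors sum to `1`. -/
theorem sum_prod_weights_smul (w : Fin n → A → ℝ) (hw : ∀ r, ∑ a, w r a = 1) (r : Fin n)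
    (v : A → E) : ∑ z : Fin n → A, (∏ l, w l (z l)) • v (z r) = ∑ a, w r a • v a := by
  classical
  have h1 : ∀ a, ∑ z : Fin n → A, (∏ l, w l (z l)) * (if z r = a then 1 else 0) = w r a := by
    intro a
    have h2 : ∀ z : Fin n → A, (∏ l, w l (z l)) * (if z r = a then 1 else 0) =
        ∏ l, (w l (z l) * if l = r then (if z l = a then 1 else 0) else 1) := by
      intro z
      rw [Finset.prod_mul_distrib]
      simp
    simp_rw [h2]
    rw [← Fintype.piFinset_univ,
      ← Finset.prod_univ_sum (fun _ => Finset.univ)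
        (fun l b => w l b * if l = r then (if b = a then 1 else 0) else 1),
      Finset.prod_eq_single r]
    · simp
    · intro l _ hl; simp [hl, hw]
    · simp
  calc ∑ z : Fin n → A, (∏ l, w l (z l)) • v (z r)
      = ∑ z : Fin n → A, ∑ a, ((∏ l, w l (z l)) * (if z r = a then 1 else 0)) • v a := by
        refine Finset.sum_congr rfl fun z _ => ?_
        simp
    _ = ∑ a, w r a • v a := by
        rw [Finset.sum_comm]
        simp_rw [← Finset.sum_smul, h1]

/-- Averaging with respect to doubly stochastic kernels does not increase the decoupled
Rademacher moments. -/
theorem sum_rademacherMoment_kernel_le (hq : 1 ≤ q) {C : ℝ} (w : Fin n → A → A → ℝ)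
    (hw0 : ∀ r a a', 0 ≤ w r a a') (hw1 : ∀ r a, ∑ a', w r a a' = 1)
    (hw2 : ∀ r a', ∑ a, w r a a' = 1) (τ : Fin n → A → A → E → E)
    (hτ : ∀ (y z : Fin n → A) (v : Fin n → E),
      rademacherMoment q (fun r => τ r (y r) (z r) (v r)) ≤ C * rademacherMoment q v)
    (v : Fin n → A → E) :
    ∑ y : Fin n → A, rademacherMoment q
        (fun r => ∑ a, w r (y r) a • τ r (y r) a (v r a)) ≤
      C * ∑ y : Fin n → A, rademacherMoment q (fun r => v r (y r)) := by
  -- Jensen for the product probability `∏ w_r(y_r, ·)` on `A^n`: by the marginal formula, the mean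
  -- of the vectors `(τ_r(y_r, z_r, v_r(z_r)))_r` is the sequence of one-coordinate averages.
  have hJ : ∀ y : Fin n → A, rademacherMoment q
      (fun r => ∑ a, w r (y r) a • τ r (y r) a (v r a)) ≤
      ∑ z : Fin n → A, (∏ r, w r (y r) (z r)) * (C * rademacherMoment q fun r => v r (z r)) := by
    intro y
    have hs := sum_prod_weights (fun r => w r (y r)) fun r => hw1 r (y r)
    have h := (convexOn_rademacherMoment (E := E) (n := n) hq).map_sum_le
      (t := Finset.univ) (w := fun z : Fin n → A => ∏ r, w r (y r) (z r))
      (p := fun z r => τ r (y r) (z r) (v r (z r)))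
      (fun z _ => Finset.prod_nonneg fun r _ => hw0 _ _ _) hs fun _ _ => trivial
    refine le_of_eq_of_le ?_ (h.trans (Finset.sum_le_sum fun z _ => ?_))
    · congr 1
      ext r
      rw [Finset.sum_apply]
      exact (sum_prod_weights_smul (fun r => w r (y r)) (fun r => hw1 r (y r)) r
        fun a => τ r (y r) a (v r a)).symm
    · exact mul_le_mul_of_nonneg_left (hτ y z _) (Finset.prod_nonneg fun r _ => hw0 _ _ _)
  refine (Finset.sum_le_sum fun y _ => hJ y).trans_eq ?_
  -- Summing over `y` first, the column sums turn the total weight of each `z` into `1`.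
  rw [Finset.sum_comm, Finset.mul_sum]
  refine Finset.sum_congr rfl fun z _ => ?_
  rw [← Finset.sum_mul, sum_prod_weights (fun r a => w r a (z r)) fun r => hw2 r (z r), one_mul]

end ProductWeights

/-! ### Decoupling of martingales on the paths of a tree -/

section Decoupling

variable {A : Type} [Fintype A] {n : ℕ}

/-- Two sequences agree before the index `r`. -/
def AgreeBefore (r : ℕ) (x x' : Fin n → A) : Prop := ∀ l : Fin n, l.val < r → x l = x' l

theorem AgreeBefore.update_left [DecidableEq A] {r : Fin n} (x : Fin n → A) (a : A) :
    AgreeBefore r (Function.update x r a) x := fun l hl =>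
  Function.update_of_ne (fun h => by simp [h] at hl) _ _

/-- The relation generating the filtration for the decoupling: the first coordinates agree, and at
odd times the next coordinates agree up to a swap. -/
def decouplingRel (t : ℕ) (ω ω' : (Fin n → A) × (Fin n → A)) : Prop :=
  AgreeBefore (t / 2) ω.1 ω'.1 ∧ AgreeBefore (t / 2) ω.2 ω'.2 ∧
    (t % 2 = 1 → ∀ l : Fin n, l.val = t / 2 →
      (ω.1 l = ω'.1 l ∧ ω.2 l = ω'.2 l) ∨ (ω.1 l = ω'.2 l ∧ ω.2 l = ω'.1 l))

theorem decouplingRel_even {r : ℕ} {ω ω' : (Fin n → A) × (Fin n → A)} :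
    decouplingRel (2 * r) ω ω' ↔ AgreeBefore r ω.1 ω'.1 ∧ AgreeBefore r ω.2 ω'.2 := by
  simp [decouplingRel]

theorem decouplingRel_odd {r : ℕ} {ω ω' : (Fin n → A) × (Fin n → A)} :
    decouplingRel (2 * r + 1) ω ω' ↔ AgreeBefore r ω.1 ω'.1 ∧ AgreeBefore r ω.2 ω'.2 ∧
      ∀ l : Fin n, l.val = r →
      (ω.1 l = ω'.1 l ∧ ω.2 l = ω'.2 l) ∨ (ω.1 l = ω'.2 l ∧ ω.2 l = ω'.1 l) := by
  have h1 : (2 * r + 1) / 2 = r := by omega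
  have h2 : (2 * r + 1) % 2 = 1 := by omega
  simp [decouplingRel, h1, h2]

theorem decouplingRel_of_succ (t : ℕ) (ω ω' : (Fin n → A) × (Fin n → A))
    (h : decouplingRel (t + 1) ω ω') : decouplingRel t ω ω' := by
  obtain ⟨r, rfl | rfl⟩ := Nat.even_or_odd' t
  · rw [decouplingRel_odd] at h
    exact decouplingRel_even.2 ⟨h.1, h.2.1⟩
  · rw [show 2 * r + 1 + 1 = 2 * (r + 1) by ring, decouplingRel_even] at h
    refine decouplingRel_odd.2 ⟨fun l hl => h.1 l (by omega), fun l hl => h.2 l (by omega),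
      fun l hl => Or.inl ⟨h.1 l (by omega), h.2 l (by omega)⟩⟩

variable {E : Type*} [NormedAddCommGroup E] [NormedSpace ℝ E]

/-- The martingale differences used for decoupling: the symmetric and the antisymmetric parts of
the differences `b r x (x r)` and `b r x (y r)`. -/
noncomputable def decouplingDiff (e₀ : E) (b : Fin n → (Fin n → A) → A → E) :
    ℕ → (Fin n → A) × (Fin n → A) → E
  | 0, _ => e₀
  | t + 1, ω =>
    if h : t / 2 < n then
      (1 / 2 : ℝ) • (b ⟨t / 2, h⟩ ω.1 (ω.1 ⟨t / 2, h⟩) +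
        (-1 : ℝ) ^ t • b ⟨t / 2, h⟩ ω.1 (ω.2 ⟨t / 2, h⟩))
    else 0

section

variable (e₀ : E) (b : Fin n → (Fin n → A) → A → E) (ω : (Fin n → A) × (Fin n → A))

theorem decouplingDiff_odd (r : Fin n) :
    decouplingDiff e₀ b (2 * r + 1) ω =
      (1 / 2 : ℝ) • (b r ω.1 (ω.1 r) + b r ω.1 (ω.2 r)) := by
  have h1 : (2 * (r : ℕ)) / 2 = r := by omega
  simp [decouplingDiff, h1]

theorem decouplingDiff_even (r : Fin n) :
    decouplingDiff e₀ b (2 * r + 1 + 1) ω =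
      (1 / 2 : ℝ) • (b r ω.1 (ω.1 r) - b r ω.1 (ω.2 r)) := by
  have h1 : (2 * (r : ℕ) + 1) / 2 = r := by omega
  have h2 : (-1 : ℝ) ^ (2 * (r : ℕ) + 1) = -1 := by rw [pow_succ, pow_mul]; simp
  simp [decouplingDiff, h1, h2, sub_eq_add_neg]

theorem decouplingDiff_of_le {t : ℕ} (h : n ≤ t / 2) : decouplingDiff e₀ b (t + 1) ω = 0 := by
  simp [decouplingDiff, not_lt.2 h]

end

/-- Exchanging `x r` with an independent variable `a` is an involution of `(Fin n → A) × A`, and `G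
x` does not see the coordinate `r` of `x`. -/
theorem card_smul_sum_resample [DecidableEq A] (r : Fin n) (G : (Fin n → A) → A → E)
    (hG : ∀ x a a', G (Function.update x r a') a = G x a) :
    (Fintype.card A : ℝ) • ∑ x, G x (x r) = ∑ x, ∑ a, G x a := by
  have hinv : Function.Involutive
      fun z : (Fin n → A) × A => (Function.update z.1 r z.2, z.1 r) := fun z => by simp
  have h1 : ∑ z : (Fin n → A) × A, G z.1 (z.1 r) = ∑ z : (Fin n → A) × A, G z.1 z.2 := by
    refine Fintype.sum_equiv (hinv.toPerm _) _ _ fun z => ?_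
    simp only [Function.Involutive.coe_toPerm, hG]
  rw [Fintype.sum_prod_type, Fintype.sum_prod_type] at h1
  rw [← h1, Finset.smul_sum]
  refine Finset.sum_congr rfl fun x _ => ?_
  simp [Nat.cast_smul_eq_nsmul]

theorem sum_resample_eq_zero [Nonempty A] [DecidableEq A] (r : Fin n) (G : (Fin n → A) → A → E)
    (hG : ∀ x a a', G (Function.update x r a') a = G x a) (h0 : ∀ x, ∑ a, G x a = 0) :
    ∑ x, G x (x r) = 0 := by
  have h := card_smul_sum_resample r G hG
  simp only [h0, Finset.sum_const_zero, smul_eq_zero] at h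
  exact h.resolve_left (by simp)

/-- `b r x a` are the increments at `a` of a martingale on the paths `x`. -/
structure IsIncrement (b : Fin n → (Fin n → A) → A → E) : Prop where
  predictable : ∀ (r : Fin n) x x' a, AgreeBefore r x x' → b r x a = b r x' a
  sum_eq_zero : ∀ (r : Fin n) x, ∑ a, b r x a = 0

namespace IsIncrement

variable {b : Fin n → (Fin n → A) → A → E}

/-- Adaptedness. The symmetric part needs only the unordered pair `{x_r, y_r}`, which is what the
odd times know; the antisymmetric part needs the ordered pair, known at the next even time. -/
theorem decouplingDiff_congr (hb : IsIncrement b) (e₀ : E) (t : ℕ)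
    (ω ω' : (Fin n → A) × (Fin n → A))
    (h : decouplingRel t ω ω') : decouplingDiff e₀ b t ω = decouplingDiff e₀ b t ω' := by
  cases t with
  | zero => rfl
  | succ t =>
    by_cases ht : n ≤ t / 2
    · rw [decouplingDiff_of_le _ _ _ ht, decouplingDiff_of_le _ _ _ ht]
    obtain ⟨r, rfl | rfl⟩ := Nat.even_or_odd' t
    · obtain ⟨r, rfl⟩ : ∃ s : Fin n, s = r := ⟨⟨r, by omega⟩, rfl⟩
      rw [decouplingRel_odd] at h
      rw [decouplingDiff_odd, decouplingDiff_odd, hb.predictable r _ _ _ h.1,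
        hb.predictable r _ _ _ h.1]
      rcases h.2.2 r rfl with h' | h'
      · rw [h'.1, h'.2]
      · rw [h'.1, h'.2, add_comm]
    · obtain ⟨r, rfl⟩ : ∃ s : Fin n, s = r := ⟨⟨r, by omega⟩, rfl⟩
      rw [show 2 * (r : ℕ) + 1 + 1 = 2 * (r + 1) by ring, decouplingRel_even] at h
      have h1 : AgreeBefore r ω.1 ω'.1 := fun l hl => h.1 l (by omega)
      rw [decouplingDiff_even, decouplingDiff_even, hb.predictable r _ _ _ h1,
        hb.predictable r _ _ _ h1, h.1 r (by omega), h.2 r (by omega)]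

/-- The martingale property. After an even time, `x_r` and `y_r` are still free and `b r` has mean
zero in each. After an odd time, exchanging `x_r` and `y_r` preserves `g` and negates the
antisymmetric part. -/
theorem sum_smul_decouplingDiff (hb : IsIncrement b) [Nonempty A] (e₀ : E) (t : ℕ)
    (g : (Fin n → A) × (Fin n → A) → ℝ) (hg : ∀ ω ω', decouplingRel t ω ω' → g ω = g ω') :
    ∑ ω, g ω • decouplingDiff e₀ b (t + 1) ω = 0 := by
  classical
  by_cases ht : n ≤ t / 2
  · simp [decouplingDiff_of_le _ _ _ ht]
  obtain ⟨r, rfl | rfl⟩ := Nat.even_or_odd' t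
  · obtain ⟨r, rfl⟩ : ∃ s : Fin n, s = r := ⟨⟨r, by omega⟩, rfl⟩
    have hg' : ∀ x y x' y', AgreeBefore r x x' → AgreeBefore r y y' → g (x, y) = g (x', y') :=
      fun x y x' y' h h' => hg _ _ (decouplingRel_even.2 ⟨h, h'⟩)
    simp_rw [decouplingDiff_odd, smul_comm _ (1 / 2 : ℝ), ← Finset.smul_sum, smul_add,
      Finset.sum_add_distrib]
    have h1 : ∑ ω : (Fin n → A) × (Fin n → A), g ω • b r ω.1 (ω.1 r) = 0 := by
      rw [Fintype.sum_prod_type_right]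
      refine Finset.sum_eq_zero fun y _ => ?_
      refine sum_resample_eq_zero r (fun x a => g (x, y) • b r x a) (fun x a a' => ?_) fun x => ?_
      · rw [hg' _ y _ y (AgreeBefore.update_left x a') fun _ _ => rfl,
          hb.predictable r _ _ _ (AgreeBefore.update_left x a')]
      · rw [← Finset.smul_sum, hb.sum_eq_zero, smul_zero]
    have h2 : ∑ ω : (Fin n → A) × (Fin n → A), g ω • b r ω.1 (ω.2 r) = 0 := by
      rw [Fintype.sum_prod_type]
      refine Finset.sum_eq_zero fun x _ => ?_
      refine sum_resample_eq_zero r (fun y a => g (x, y) • b r x a) (fun y a a' => ?_) fun y => ?_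
      · rw [hg' x _ x _ (fun _ _ => rfl) (AgreeBefore.update_left y a')]
      · rw [← Finset.smul_sum, hb.sum_eq_zero, smul_zero]
    rw [h1, h2, add_zero, smul_zero]
  · obtain ⟨r, rfl⟩ : ∃ s : Fin n, s = r := ⟨⟨r, by omega⟩, rfl⟩
    have hinv : Function.Involutive fun ω : (Fin n → A) × (Fin n → A) =>
        (Function.update ω.1 r (ω.2 r), Function.update ω.2 r (ω.1 r)) := fun ω => by simp
    have h1 : ∑ ω, g ω • decouplingDiff e₀ b (2 * r + 1 + 1) ω =
        ∑ ω, -(g ω • decouplingDiff e₀ b (2 * r + 1 + 1) ω) := by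
      refine Fintype.sum_equiv (hinv.toPerm _) _ _ fun ω => ?_
      · have h2 : g (Function.update ω.1 r (ω.2 r), Function.update ω.2 r (ω.1 r)) = g ω := by
          refine hg _ _ (decouplingRel_odd.2 ⟨AgreeBefore.update_left _ _,
            AgreeBefore.update_left _ _, fun l hl => Or.inr ?_⟩)
          obtain rfl := Fin.ext hl
          simp
        simp only [Function.Involutive.coe_toPerm, h2, decouplingDiff_even]
        rw [hb.predictable r _ _ _ (AgreeBefore.update_left _ _),
          hb.predictable r _ _ _ (AgreeBefore.update_left _ _)]
        simp only [Function.update_self]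
        rw [← smul_neg, ← smul_neg, neg_sub]
    rw [Finset.sum_neg_distrib] at h1
    have h3 := add_eq_zero_iff_eq_neg.2 h1
    rw [← two_smul ℝ, smul_eq_zero] at h3
    exact h3.resolve_left two_ne_zero

end IsIncrement

theorem sum_range_two_mul_succ {F : Type*} [AddCommMonoid F] (g : ℕ → F) (n : ℕ) :
    ∑ t ∈ Finset.range (2 * n + 1), g t =
      g 0 + ∑ r : Fin n, (g (2 * r + 1) + g (2 * r + 1 + 1)) := by
  rw [Finset.sum_range_succ', add_comm,
    Fin.sum_univ_eq_sum_range fun r => g (2 * r + 1) + g (2 * r + 1 + 1)]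
  congr 1
  induction n with
  | zero => simp
  | succ n ih =>
    rw [show 2 * (n + 1) = 2 * n + 1 + 1 by ring, Finset.sum_range_succ, Finset.sum_range_succ, ih,
      Finset.sum_range_succ, add_assoc]

/-- The signs that turn a martingale into its decoupled randomized version. -/
def decouplingSign (η : ℤˣ) (ε : Fin n → ℤˣ) : ℕ → ℤˣ
  | 0 => η
  | t + 1 => if h : t / 2 < n then (-1) ^ t * ε ⟨t / 2, h⟩ else 1

theorem decouplingSign_odd (η : ℤˣ) (ε : Fin n → ℤˣ) (r : Fin n) :
    decouplingSign η ε (2 * r + 1) = ε r := by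
  have h1 : (2 * (r : ℕ)) / 2 = r := by omega
  simp [decouplingSign, h1]

theorem decouplingSign_even (η : ℤˣ) (ε : Fin n → ℤˣ) (r : Fin n) :
    decouplingSign η ε (2 * r + 1 + 1) = -ε r := by
  have h1 : (2 * (r : ℕ) + 1) / 2 = r := by omega
  have h2 : (-1 : ℤˣ) ^ (2 * (r : ℕ) + 1) = -1 := by rw [pow_succ, pow_mul]; simp
  simp [decouplingSign, h1, h2]

theorem sum_decouplingDiff (e₀ : E) (b : Fin n → (Fin n → A) → A → E)
    (ω : (Fin n → A) × (Fin n → A)) :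
    ∑ t ∈ Finset.range (2 * n + 1), decouplingDiff e₀ b t ω = e₀ + ∑ r, b r ω.1 (ω.1 r) := by
  rw [sum_range_two_mul_succ]
  congr 1
  refine Finset.sum_congr rfl fun r _ => ?_
  rw [decouplingDiff_odd, decouplingDiff_even]
  module

/-- The decoupling trick: symmetric plus antisymmetric part is `b r x (x r)`, while symmetric minus
antisymmetric part is `b r x (y r)`. So the signs `ε_r, -ε_r` replace `x_r` by `y_r` and randomize
at the same time. -/
theorem sum_decouplingSign_smul_decouplingDiff (η : ℤˣ) (ε : Fin n → ℤˣ) (e₀ : E)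
    (b : Fin n → (Fin n → A) → A → E) (ω : (Fin n → A) × (Fin n → A)) :
    ∑ t ∈ Finset.range (2 * n + 1), decouplingSign η ε t • decouplingDiff e₀ b t ω =
      η • e₀ + ∑ r, ε r • b r ω.1 (ω.2 r) := by
  rw [sum_range_two_mul_succ]
  congr 1
  refine Finset.sum_congr rfl fun r _ => ?_
  rw [decouplingDiff_odd, decouplingDiff_even, decouplingSign_odd, decouplingSign_even,
    Units.neg_smul, ← smul_neg, ← smul_add]
  congr 1
  module

variable [CompleteSpace E] [Nonempty A] {p : ℝ≥0∞} {β : ℝ≥0}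
  {b : Fin n → (Fin n → A) → A → E}

theorem IsUMDConstant.decouple_le (hβ : IsUMDConstant E p β) (hp0 : p ≠ 0) (hp : p ≠ ∞)
    (hb : IsIncrement b) (e₀ : E) (η : ℤˣ) (ε : Fin n → ℤˣ) :
    ∑ ω : (Fin n → A) × (Fin n → A), ‖η • e₀ + ∑ r, ε r • b r ω.1 (ω.2 r)‖ ^ p.toReal ≤
      (β : ℝ) ^ p.toReal *
        ∑ ω : (Fin n → A) × (Fin n → A), ‖e₀ + ∑ r, b r ω.1 (ω.1 r)‖ ^ p.toReal := by
  have h := hβ.sum_norm_rpow_le hp0 hp decouplingRel_of_succ (hb.decouplingDiff_congr e₀)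
    (hb.sum_smul_decouplingDiff e₀) (2 * n + 1) (decouplingSign η ε)
  simpa only [sum_decouplingSign_smul_decouplingDiff, sum_decouplingDiff] using h

/-- The already signed differences are again martingale differences; applying the same signs a
second time restores the original martingale. -/
theorem IsUMDConstant.recouple_le (hβ : IsUMDConstant E p β) (hp0 : p ≠ 0) (hp : p ≠ ∞)
    (hb : IsIncrement b) (ε : Fin n → ℤˣ) :
    ∑ ω : (Fin n → A) × (Fin n → A), ‖∑ r, b r ω.1 (ω.1 r)‖ ^ p.toReal ≤
      (β : ℝ) ^ p.toReal *
        ∑ ω : (Fin n → A) × (Fin n → A), ‖∑ r, ε r • b r ω.1 (ω.2 r)‖ ^ p.toReal := by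
  have h := hβ.sum_norm_rpow_le hp0 hp decouplingRel_of_succ
    (d := fun t ω => decouplingSign 1 ε t • decouplingDiff (0 : E) b t ω)
    (fun t ω ω' h => by rw [hb.decouplingDiff_congr 0 t ω ω' h])
    (fun t g hg => by
      simp_rw [smul_comm _ (decouplingSign 1 ε (t + 1)), ← Finset.smul_sum]
      rw [hb.sum_smul_decouplingDiff 0 t g hg, smul_zero]) (2 * n + 1) (decouplingSign 1 ε)
  simp only [smul_smul, Int.units_mul_self, one_smul,
    sum_decouplingSign_smul_decouplingDiff, sum_decouplingDiff] at h
  simpa using h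

end Decoupling

/-! ### Decoupling averaged over random signs -/

section RandomizedDecoupling

variable {A : Type} [Fintype A] [Nonempty A] {n : ℕ} {E : Type*} [NormedAddCommGroup E]
  [NormedSpace ℝ E] [CompleteSpace E] {p : ℝ≥0∞} {β : ℝ≥0} {b : Fin n → (Fin n → A) → A → E}

theorem one_le_toReal {p : ℝ≥0∞} (hp1 : 1 ≤ p) (hp : p ≠ ∞) : 1 ≤ p.toReal := by
  simpa using ENNReal.toReal_mono hp hp1

/-- The initial value `e₀`, later the average of `f` over the top cube, has its own sign `η`.
Convexity over `η = ±1` removes it from the left side, so `f` need not have mean zero. -/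
theorem IsUMDConstant.sum_rademacherMoment_le (hβ : IsUMDConstant E p β) (hp1 : 1 ≤ p)
    (hp : p ≠ ∞) (hb : IsIncrement b) (e₀ : E) :
    ∑ ω : (Fin n → A) × (Fin n → A), rademacherMoment p.toReal (fun r => b r ω.1 (ω.2 r)) ≤
      (β : ℝ) ^ p.toReal *
        ∑ ω : (Fin n → A) × (Fin n → A), ‖e₀ + ∑ r, b r ω.1 (ω.1 r)‖ ^ p.toReal := by
  have hp0 : p ≠ 0 := (zero_lt_one.trans_le hp1).ne'
  set S := ∑ ω : (Fin n → A) × (Fin n → A), ‖e₀ + ∑ r, b r ω.1 (ω.1 r)‖ ^ p.toReal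
  have h : ∀ ε : Fin n → ℤˣ, ∑ ω : (Fin n → A) × (Fin n → A),
      ‖∑ r, ε r • b r ω.1 (ω.2 r)‖ ^ p.toReal ≤ (β : ℝ) ^ p.toReal * S := by
    intro ε
    have h1 := hβ.decouple_le hp0 hp hb e₀ 1 ε
    have h2 := hβ.decouple_le hp0 hp hb e₀ (-1) ε
    have h3 : ∀ X : E, ‖X‖ ^ p.toReal ≤ (1 / 2 : ℝ) * ‖(1 : ℤˣ) • e₀ + X‖ ^ p.toReal +
        (1 / 2 : ℝ) * ‖(-1 : ℤˣ) • e₀ + X‖ ^ p.toReal := by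
      intro X
      have := (convexOn_norm_rpow (E := E) (one_le_toReal hp1 hp)).2
        (Set.mem_univ ((1 : ℤˣ) • e₀ + X)) (Set.mem_univ ((-1 : ℤˣ) • e₀ + X))
        (by norm_num : (0 : ℝ) ≤ 1 / 2) (by norm_num : (0 : ℝ) ≤ 1 / 2) (by norm_num)
      refine le_of_eq_of_le ?_ this
      congr 2
      simp only [one_smul, Units.neg_smul]
      module
    refine (Finset.sum_le_sum fun ω _ => h3 _).trans ?_
    rw [Finset.sum_add_distrib, ← Finset.mul_sum, ← Finset.mul_sum]
    linarith
  unfold rademacherMoment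
  rw [← Finset.mul_sum, Finset.sum_comm]
  refine (mul_le_mul_of_nonneg_left (Finset.sum_le_sum fun ε _ => h ε) (by positivity)).trans_eq ?_
  simp

/-- The recoupling inequality holds for each choice of signs, so it may be averaged over them. -/
theorem IsUMDConstant.le_sum_rademacherMoment (hβ : IsUMDConstant E p β) (hp1 : 1 ≤ p)
    (hp : p ≠ ∞) (hb : IsIncrement b) :
    ∑ ω : (Fin n → A) × (Fin n → A), ‖∑ r, b r ω.1 (ω.1 r)‖ ^ p.toReal ≤
      (β : ℝ) ^ p.toReal *
      ∑ ω : (Fin n → A) × (Fin n → A), rademacherMoment p.toReal (fun r => b r ω.1 (ω.2 r)) := by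
  have hp0 : p ≠ 0 := (zero_lt_one.trans_le hp1).ne'
  unfold rademacherMoment
  rw [← Finset.mul_sum, Finset.sum_comm, mul_left_comm, Finset.mul_sum]
  rw [inv_mul_eq_div, le_div_iff₀ (by positivity)]
  refine le_of_eq_of_le ?_ (Finset.sum_le_sum fun ε _ => hβ.recouple_le hp0 hp hb ε)
  simp [mul_comm]

end RandomizedDecoupling

/-! ### The discrete model of the shift and its estimate -/

section DiscreteShift

variable {A : Type} [Fintype A] {E : Type*} [NormedAddCommGroup E] [NormedSpace ℝ E]

/-- A doubly stochastic kernel on a finite type. -/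
structure IsDoublyStochastic (w : A → A → ℝ) : Prop where
  nonneg : ∀ a a', 0 ≤ w a a'
  row_sum : ∀ a, ∑ a', w a a' = 1
  col_sum : ∀ a', ∑ a, w a a' = 1

/-- The average with weights `w` of a function on `A`, after applying the maps `τ`. -/
def kernelMap (w : A → A → ℝ) (τ : A → A → E → E) (v : A → E) (a : A) : E :=
  ∑ a', w a a' • τ a a' (v a')

/-- The uniform kernel. -/
noncomputable def uniformKernel (A : Type) [Fintype A] : A → A → ℝ := fun _ _ => (Fintype.card A : ℝ)⁻¹

theorem isDoublyStochastic_uniformKernel [Nonempty A] : IsDoublyStochastic (uniformKernel A) where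
  nonneg _ _ := by unfold uniformKernel; positivity
  row_sum _ := by simp [uniformKernel]
  col_sum _ := by simp [uniformKernel]

theorem sum_kernelMap {A : Type} [Fintype A] {w : A → A → ℝ} (hw : IsDoublyStochastic w)
    (v : A → E) : ∑ a, kernelMap w (fun _ _ e => e) v a = ∑ a, v a := by
  unfold kernelMap
  rw [Finset.sum_comm]
  simp_rw [← Finset.sum_smul, hw.col_sum, one_smul]

/-- The difference of the averages with weights `w₁` and `w₂`. -/
def kernelDiff (w₁ w₂ : A → A → ℝ) (v : A → E) (a : A) : E :=
  kernelMap w₁ (fun _ _ e => e) v a - kernelMap w₂ (fun _ _ e => e) v a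

/-- This makes the output of the discrete shift an increment again, so that it can be recoupled. -/
theorem sum_kernelDiff {w₁ w₂ : A → A → ℝ} (h₁ : IsDoublyStochastic w₁)
    (h₂ : IsDoublyStochastic w₂) (v : A → E) : ∑ a, kernelDiff w₁ w₂ v a = 0 := by
  simp only [kernelDiff, Finset.sum_sub_distrib, sum_kernelMap h₁, sum_kernelMap h₂, sub_self]

/-- The discrete model of `D^j_K A_K D^i_K`. -/
noncomputable def discreteShift (w₁ w₂ u₁ u₂ : A → A → ℝ) (τ : A → A → E → E) (v : A → E) : A → E :=
  kernelDiff w₁ w₂ (kernelMap (uniformKernel A) τ (kernelDiff u₁ u₂ v))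

variable {q : ℝ} {n : ℕ}

theorem sum_rademacherMoment_kernelDiff_le (hq : 1 ≤ q) {w₁ w₂ : Fin n → A → A → ℝ}
    (h₁ : ∀ r, IsDoublyStochastic (w₁ r)) (h₂ : ∀ r, IsDoublyStochastic (w₂ r))
    (v : Fin n → A → E) :
    ∑ y : Fin n → A, rademacherMoment q (fun r => kernelDiff (w₁ r) (w₂ r) (v r) (y r)) ≤
      2 ^ q * ∑ y : Fin n → A, rademacherMoment q (fun r => v r (y r)) := by
  have h : ∀ w : Fin n → A → A → ℝ, (∀ r, IsDoublyStochastic (w r)) →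
      ∑ y : Fin n → A, rademacherMoment q
        (fun r => kernelMap (w r) (fun _ _ e => e) (v r) (y r)) ≤
      ∑ y : Fin n → A, rademacherMoment q (fun r => v r (y r)) := by
    intro w hw
    have := sum_rademacherMoment_kernel_le hq (C := 1) w (fun r => (hw r).nonneg)
      (fun r => (hw r).row_sum) (fun r => (hw r).col_sum) (fun _ _ _ e => e)
      (fun y z v => (one_mul _).ge) v
    rwa [one_mul] at this
  refine (Finset.sum_le_sum fun y _ => rademacherMoment_sub_le hq _ _).trans ?_
  rw [← Finset.mul_sum, ← Finset.sum_div, Finset.sum_add_distrib]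
  have h3 := h w₁ h₁
  have h4 := h w₂ h₂
  refine mul_le_mul_of_nonneg_left ?_ (by positivity)
  linarith

/-- Three successive applications of Jensen's inequality, with factors `2`, `C` and `2`. -/
theorem sum_rademacherMoment_discreteShift_le [Nonempty A] (hq : 1 ≤ q) {C : ℝ} (hC : 0 ≤ C)
    {w₁ w₂ u₁ u₂ : Fin n → A → A → ℝ}
    (hw₁ : ∀ r, IsDoublyStochastic (w₁ r)) (hw₂ : ∀ r, IsDoublyStochastic (w₂ r))
    (hu₁ : ∀ r, IsDoublyStochastic (u₁ r)) (hu₂ : ∀ r, IsDoublyStochastic (u₂ r))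
    (τ : Fin n → A → A → E → E)
    (hτ : ∀ (y z : Fin n → A) (v : Fin n → E),
      rademacherMoment q (fun r => τ r (y r) (z r) (v r)) ≤ C ^ q * rademacherMoment q v)
    (v : Fin n → A → E) :
    ∑ y : Fin n → A, rademacherMoment q
        (fun r => discreteShift (w₁ r) (w₂ r) (u₁ r) (u₂ r) (τ r) (v r) (y r)) ≤
      (4 * C) ^ q * ∑ y : Fin n → A, rademacherMoment q (fun r => v r (y r)) := by
  have hu := isDoublyStochastic_uniformKernel (A := A)
  have h1 := sum_rademacherMoment_kernelDiff_le hq hw₁ hw₂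
    fun r => kernelMap (uniformKernel A) (τ r) (kernelDiff (u₁ r) (u₂ r) (v r))
  have h2 := sum_rademacherMoment_kernel_le hq (fun _ => uniformKernel A) (fun _ => hu.nonneg)
    (fun _ => hu.row_sum) (fun _ => hu.col_sum) τ hτ fun r => kernelDiff (u₁ r) (u₂ r) (v r)
  have h3 := sum_rademacherMoment_kernelDiff_le hq hu₁ hu₂ v
  refine h1.trans ((mul_le_mul_of_nonneg_left (h2.trans
    (mul_le_mul_of_nonneg_left h3 (by positivity))) (by positivity)).trans_eq ?_)
  rw [show (4 : ℝ) * C = 2 * (C * 2) by ring, Real.mul_rpow two_pos.le (by positivity),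
    Real.mul_rpow hC two_pos.le]
  ring

variable [CompleteSpace E] {p : ℝ≥0∞} {β : ℝ≥0}

/-- The discrete shift estimate: the shift acting on the increments of a martingale on the paths
of a homogeneous tree, with nodes `ν r x`. -/
theorem IsUMDConstant.sum_norm_discreteShift_le [Nonempty A] (hβ : IsUMDConstant E p β)
    (hp1 : 1 ≤ p) (hp : p ≠ ∞) {𝒩 : Type*} (ν : Fin n → (Fin n → A) → 𝒩)
    (hν : ∀ (r : Fin n) x x', AgreeBefore r x x' → ν r x = ν r x')
    {B : 𝒩 → A → E} (hB : ∀ K, ∑ a, B K a = 0) (P : 𝒩 → Prop) [DecidablePred P]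
    {w₁ w₂ u₁ u₂ : 𝒩 → A → A → ℝ}
    (hw₁ : ∀ K, IsDoublyStochastic (w₁ K)) (hw₂ : ∀ K, IsDoublyStochastic (w₂ K))
    (hu₁ : ∀ K, IsDoublyStochastic (u₁ K)) (hu₂ : ∀ K, IsDoublyStochastic (u₂ K))
    {τ : 𝒩 → A → A → E → E} {C : ℝ} (hC : 0 ≤ C)
    (hτ : ∀ (K : Fin n → 𝒩) (y z : Fin n → A) (v : Fin n → E),
      rademacherMoment p.toReal (fun r => τ (K r) (y r) (z r) (v r)) ≤
        C ^ p.toReal * rademacherMoment p.toReal v) (e₀ : E) :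
    ∑ x : Fin n → A, ‖∑ r, if P (ν r x) then discreteShift (w₁ (ν r x)) (w₂ (ν r x))
        (u₁ (ν r x)) (u₂ (ν r x)) (τ (ν r x)) (B (ν r x)) (x r) else 0‖ ^ p.toReal ≤
      (4 * C * β ^ 2) ^ p.toReal * ∑ x : Fin n → A, ‖e₀ + ∑ r, B (ν r x) (x r)‖ ^ p.toReal := by
  have hq := one_le_toReal hp1 hp
  let G : 𝒩 → A → E := fun K =>
    discreteShift (w₁ K) (w₂ K) (u₁ K) (u₂ K) (τ K) (B K)
  have hb : IsIncrement fun r x a => B (ν r x) a :=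
    ⟨fun r x x' a h => by rw [hν r x x' h], fun r x => hB _⟩
  have hg : IsIncrement fun r x a => if P (ν r x) then G (ν r x) a else 0 := by
    refine ⟨fun r x x' a h => by rw [hν r x x' h], fun r x => ?_⟩
    by_cases h : P (ν r x)
    · simp only [h, if_true]
      exact sum_kernelDiff (hw₁ _) (hw₂ _) _
    · simp [h]
  have h1 := hβ.le_sum_rademacherMoment hp1 hp hg
  have h3 := hβ.sum_rademacherMoment_le hp1 hp hb e₀
  -- For frozen `x` the nodes are fixed and the `y_r` are independent, so the kernels act on
  -- separate coordinates. The restriction to nodes satisfying `P` is removed by contraction.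
  have h2 : ∑ ω : (Fin n → A) × (Fin n → A), rademacherMoment p.toReal
      (fun r => if P (ν r ω.1) then G (ν r ω.1) (ω.2 r) else 0) ≤
      (4 * C) ^ p.toReal * ∑ ω : (Fin n → A) × (Fin n → A),
        rademacherMoment p.toReal (fun r => B (ν r ω.1) (ω.2 r)) := by
    rw [Fintype.sum_prod_type, Fintype.sum_prod_type, Finset.mul_sum]
    refine Finset.sum_le_sum fun x _ => ?_
    refine (Finset.sum_le_sum fun y _ => rademacherMoment_ite_le hq _ _).trans ?_
    exact sum_rademacherMoment_discreteShift_le hq hC (fun r => hw₁ (ν r x))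
      (fun r => hw₂ (ν r x)) (fun r => hu₁ (ν r x)) (fun r => hu₂ (ν r x)) (fun r => τ (ν r x))
      (hτ fun r => ν r x) fun r => B (ν r x)
  have h4 := h1.trans ((mul_le_mul_of_nonneg_left (h2.trans
    (mul_le_mul_of_nonneg_left h3 (by positivity))) (by positivity)))
  -- The two undecoupled sums do not involve `y`: both carry the factor `card (Fin n → A)`, which
  -- cancels.
  rw [Fintype.sum_prod_type, Fintype.sum_prod_type] at h4
  simp only [Finset.sum_const, nsmul_eq_mul, ← Finset.mul_sum] at h4
  have hc : (0 : ℝ) < (Finset.univ : Finset (Fin n → A)).card := by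
    exact_mod_cast Finset.card_pos.2 Finset.univ_nonempty
  refine le_of_mul_le_mul_left (h4.trans_eq ?_) hc
  rw [show 4 * C * (β : ℝ) ^ 2 = β * ((4 * C) * β) by ring, Real.mul_rpow β.coe_nonneg (by positivity),
    Real.mul_rpow (by positivity) β.coe_nonneg]
  ring

end DiscreteShift

/-! ### Geometry of translated dyadic cubes -/

section Cubes

variable {d : ℕ} (ω : DyadicParam d)

theorem dyadicShiftVector_eq (k : ℤ) (c : Fin d) :
    dyadicShiftVector ω k c =
      (2 : ℝ) ^ (-(k + 1)) * ((ω (k + 1) c : ℕ) : ℝ) + dyadicShiftVector ω (k + 1) c := by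
  have hs : Summable fun n : ℕ =>
      (2 : ℝ) ^ (-(k + 1 + n)) * ((ω (k + 1 + n) c : ℕ) : ℝ) := by
    refine Summable.of_nonneg_of_le (f := fun n : ℕ => (2 : ℝ) ^ (-(k + 1)) * (1 / 2) ^ n)
      (fun n => by positivity) (fun n => ?_)
      ((summable_geometric_of_lt_one (by norm_num) (by norm_num)).mul_left _)
    have h1 : (2 : ℝ) ^ (-(k + 1 + n)) = (2 : ℝ) ^ (-(k + 1)) * (1 / 2) ^ n := by
      rw [neg_add, zpow_add₀ two_ne_zero, one_div, inv_pow, zpow_neg _ (n : ℤ), zpow_natCast]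
    have h2 : ((ω (k + 1 + n) c : ℕ) : ℝ) ≤ 1 := by
      have := (ω (k + 1 + n) c).2
      exact_mod_cast (by omega : (ω (k + 1 + n) c : ℕ) ≤ 1)
    rw [h1]
    exact mul_le_of_le_one_right (by positivity) h2
  unfold dyadicShiftVector
  rw [hs.tsum_eq_zero_add]
  simp only [Nat.cast_zero, add_zero, Nat.cast_add, Nat.cast_one]
  congr 2
  ext n
  rw [show k + 1 + ((n : ℤ) + 1) = k + 1 + 1 + n by ring]

/-- The index of the dyadic cube of side length `2 ^ (-k)` that contains `x`. -/
noncomputable def dyadicIndex (k : ℤ) (x : Fin d → ℝ) : Fin d → ℤ := fun c =>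
  ⌊(2 : ℝ) ^ k * (x c - dyadicShiftVector ω k c)⌋

/-- The dyadic cube of side length `2 ^ (-k)` that contains `x`. -/
noncomputable def cubeAt (k : ℤ) (x : Fin d → ℝ) : DyadicCube d := (k, dyadicIndex ω k x)

variable {ω}

@[simp] theorem cubeAt_fst (k : ℤ) (x : Fin d → ℝ) : (cubeAt ω k x).1 = k := rfl

theorem mem_dyadicCube_iff_index {k : ℤ} {m : Fin d → ℤ} {x : Fin d → ℝ} :
    x ∈ dyadicCube ω (k, m) ↔ dyadicIndex ω k x = m := by
  rw [funext_iff]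
  refine forall_congr' fun c => ?_
  have h : (0 : ℝ) < 2 ^ k := by positivity
  simp only [dyadicIndex, Int.floor_eq_iff, zpow_neg]
  rw [← le_sub_iff_add_le, ← sub_lt_iff_lt_add, inv_mul_le_iff₀ h, lt_inv_mul_iff₀ h]

theorem mem_dyadicCube_iff {Q : DyadicCube d} {x : Fin d → ℝ} :
    x ∈ dyadicCube ω Q ↔ cubeAt ω Q.1 x = Q := by
  obtain ⟨k, m⟩ := Q
  rw [mem_dyadicCube_iff_index]
  simp [cubeAt]

theorem mem_cubeAt (k : ℤ) (x : Fin d → ℝ) : x ∈ dyadicCube ω (cubeAt ω k x) :=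
  mem_dyadicCube_iff.2 rfl

/-- The translations of consecutive generations differ by `2 ^ (-(k + 1)) ω_{k+1}`, which is
`ω_{k+1}` finer cubes. Hence the coarse index is a function of the fine one, and this makes the
translated cubes nested. -/
theorem dyadicIndex_eq_div (k : ℤ) (x : Fin d → ℝ) (c : Fin d) :
    dyadicIndex ω k x c = (dyadicIndex ω (k + 1) x c - (ω (k + 1) c : ℕ)) / 2 := by
  set w : ℤ := ((ω (k + 1) c : ℕ) : ℤ) with hw
  have hw' : ((ω (k + 1) c : ℕ) : ℝ) = (w : ℝ) := by simp [hw]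
  have h1 : (2 : ℝ) ^ k * (x c - dyadicShiftVector ω k c) =
      ((2 : ℝ) ^ (k + 1) * (x c - dyadicShiftVector ω (k + 1) c) - w) / 2 := by
    rw [dyadicShiftVector_eq, hw', zpow_neg, zpow_add₀ two_ne_zero, zpow_one]
    field_simp
    ring
  unfold dyadicIndex
  rw [h1]
  set u := (2 : ℝ) ^ (k + 1) * (x c - dyadicShiftVector ω (k + 1) c)
  have h2 := Int.floor_le u
  have h3 := Int.lt_floor_add_one u
  set m := ⌊u⌋
  have h4 : 2 * ((m - w) / 2) ≤ m - w := by omega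
  have h5 : m - w ≤ 2 * ((m - w) / 2) + 1 := by omega
  have h4' : (2 : ℝ) * (((m - w) / 2 : ℤ) : ℝ) ≤ m - w := by exact_mod_cast h4
  have h5' : (m : ℝ) - w ≤ 2 * (((m - w) / 2 : ℤ) : ℝ) + 1 := by exact_mod_cast h5
  rw [Int.floor_eq_iff]
  constructor <;> linarith

theorem cubeAt_eq_of_le {k l : ℤ} (hkl : k ≤ l) {x y : Fin d → ℝ}
    (h : cubeAt ω l x = cubeAt ω l y) : cubeAt ω k x = cubeAt ω k y := by
  obtain ⟨n, rfl⟩ := Int.le.dest hkl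
  induction n with
  | zero => simpa using h
  | succ n ih =>
    refine ih (by omega) ?_
    simp only [cubeAt, Prod.mk.injEq, true_and] at h ⊢
    ext c
    rw [Nat.cast_add, Nat.cast_one, ← add_assoc] at h
    rw [dyadicIndex_eq_div, h, ← dyadicIndex_eq_div]

theorem dyadicCube_subset_of_mem {I K : DyadicCube d} (h : K.1 ≤ I.1) {z : Fin d → ℝ}
    (hI : z ∈ dyadicCube ω I) (hK : z ∈ dyadicCube ω K) : dyadicCube ω I ⊆ dyadicCube ω K := by
  intro x hx
  rw [mem_dyadicCube_iff] at *
  rw [← hK]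
  exact cubeAt_eq_of_le h (hx.trans hI.symm)

variable (ω) in
theorem dyadicCube_eq_pi (Q : DyadicCube d) : dyadicCube ω Q = Set.univ.pi fun c =>
    Set.Ico ((2 : ℝ) ^ (-Q.1) * Q.2 c + dyadicShiftVector ω Q.1 c)
      ((2 : ℝ) ^ (-Q.1) * (Q.2 c + 1) + dyadicShiftVector ω Q.1 c) := by
  ext x
  simp [dyadicCube]

variable (ω) in
theorem measurableSet_dyadicCube (Q : DyadicCube d) : MeasurableSet (dyadicCube ω Q) := by
  rw [dyadicCube_eq_pi]
  exact MeasurableSet.univ_pi fun c => measurableSet_Ico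

variable (ω) in
theorem volume_dyadicCube (Q : DyadicCube d) :
    volume (dyadicCube ω Q) = ENNReal.ofReal ((2 : ℝ) ^ (-Q.1)) ^ d := by
  rw [dyadicCube_eq_pi, Real.volume_pi_Ico]
  rw [Finset.prod_congr rfl fun c _ => by
    rw [show (2 : ℝ) ^ (-Q.1) * (Q.2 c + 1) + dyadicShiftVector ω Q.1 c -
      ((2 : ℝ) ^ (-Q.1) * Q.2 c + dyadicShiftVector ω Q.1 c) = (2 : ℝ) ^ (-Q.1) by ring]]
  simp

variable (ω) in
theorem volume_dyadicCube_ne_top (Q : DyadicCube d) : volume (dyadicCube ω Q) ≠ ∞ := by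
  rw [volume_dyadicCube]; exact ENNReal.pow_ne_top ENNReal.ofReal_ne_top

variable (ω) in
theorem volume_dyadicCube_ne_zero (Q : DyadicCube d) : volume (dyadicCube ω Q) ≠ 0 := by
  rw [volume_dyadicCube]
  exact pow_ne_zero _ (ENNReal.ofReal_pos.2 (by positivity)).ne'

variable (ω) in
theorem dyadicCube_nonempty (Q : DyadicCube d) : (dyadicCube ω Q).Nonempty :=
  nonempty_of_measure_ne_zero (volume_dyadicCube_ne_zero ω Q)

theorem dyadicCube_disjoint {I J : DyadicCube d} (h : I.1 = J.1) (hIJ : I ≠ J) :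
    Disjoint (dyadicCube ω I) (dyadicCube ω J) := by
  refine Set.disjoint_left.2 fun x hI hJ => hIJ ?_
  rw [mem_dyadicCube_iff] at hI hJ
  rw [← hI, ← hJ, h]

theorem cubeAt_mem_descendants {K : DyadicCube d} {x : Fin d → ℝ} (hx : x ∈ dyadicCube ω K)
    (s : ℕ) : cubeAt ω (K.1 + s) x ∈ dyadicDescendants ω s K :=
  ⟨rfl, dyadicCube_subset_of_mem (by simp) (mem_cubeAt _ _) hx⟩

theorem iUnion_descendants (s : ℕ) (K : DyadicCube d) :
    ⋃ I : dyadicDescendants ω s K, dyadicCube ω I.1 = dyadicCube ω K := by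
  ext x
  simp only [Set.mem_iUnion]
  exact ⟨fun ⟨I, hI⟩ => I.2.2 hI, fun hx => ⟨⟨_, cubeAt_mem_descendants hx s⟩, mem_cubeAt _ _⟩⟩

theorem descendants_disjoint (s : ℕ) (K : DyadicCube d) :
    Pairwise (Function.onFun Disjoint
      fun I : dyadicDescendants ω s K => dyadicCube ω I.1) := fun I J hIJ =>
  dyadicCube_disjoint (I.2.1.trans J.2.1.symm) fun h => hIJ (Subtype.ext h)

/-- Counted by volume: the descendants partition `K` and have equal volume. Working in `ℕ∞` yields
finiteness as well. -/
theorem card_descendants (s : ℕ) (K : DyadicCube d) :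
    ENat.card (dyadicDescendants ω s K) = ((2 ^ (s * d) : ℕ) : ℕ∞) := by
  have h1 := measure_iUnion (μ := volume) (descendants_disjoint (ω := ω) s K)
    fun I => measurableSet_dyadicCube ω I.1
  rw [iUnion_descendants] at h1
  have h2 : ∀ I : dyadicDescendants ω s K, volume (dyadicCube ω I.1) =
      ENNReal.ofReal ((2 : ℝ) ^ (-(K.1 + s))) ^ d := fun I => by
    rw [volume_dyadicCube, I.2.1]
  simp_rw [h2, ENNReal.tsum_const] at h1
  rw [volume_dyadicCube, show -K.1 = s + -(K.1 + s) by ring, zpow_add₀ two_ne_zero,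
    ENNReal.ofReal_mul (by positivity), mul_pow, zpow_natCast, ENNReal.ofReal_pow two_pos.le,
    ← pow_mul, ENNReal.ofReal_ofNat] at h1
  have h3 : ENNReal.ofReal ((2 : ℝ) ^ (-(K.1 + s))) ^ d ≠ 0 :=
    pow_ne_zero _ (ENNReal.ofReal_pos.2 (by positivity)).ne'
  rw [ENNReal.mul_left_inj h3 (ENNReal.pow_ne_top ENNReal.ofReal_ne_top)] at h1
  have h4 : ((((2 ^ (s * d) : ℕ) : ℕ∞) : ℝ≥0∞)) =
      ((ENat.card (dyadicDescendants ω s K) : ℕ∞) : ℝ≥0∞) := by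
    rw [← h1]; simp
  exact (ENat.toENNReal_inj.1 h4).symm

variable (ω) in
/-- An enumeration of the dyadic descendants of a cube. -/
noncomputable def descendantsEquiv (s : ℕ) (K : DyadicCube d) :
    Fin (2 ^ (s * d)) ≃ dyadicDescendants ω s K :=
  have h := card_descendants (ω := ω) s K
  have : Finite (dyadicDescendants ω s K) := by
    rw [← ENat.card_lt_top, h]; exact ENat.natCast_lt_top _
  (Finite.equivFinOfCardEq (by exact_mod_cast (ENat.card_eq_coe_natCard _).symm.trans h)).symm

variable (ω) in
/-- The `a`-th descendant of `K`. -/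
noncomputable def dyadicChild (s : ℕ) (K : DyadicCube d) (a : Fin (2 ^ (s * d))) : DyadicCube d :=
  (descendantsEquiv ω s K a).1

end Cubes

/-! ### Children and ancestors of a cube -/

section Children

variable {d : ℕ} {ω : DyadicParam d} {s : ℕ} {K : DyadicCube d}

theorem dyadicChild_fst (a : Fin (2 ^ (s * d))) : (dyadicChild ω s K a).1 = K.1 + s :=
  (descendantsEquiv ω s K a).2.1

theorem dyadicChild_subset (a : Fin (2 ^ (s * d))) :
    dyadicCube ω (dyadicChild ω s K a) ⊆ dyadicCube ω K := (descendantsEquiv ω s K a).2.2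

theorem dyadicChild_injective : Function.Injective (dyadicChild ω s K) :=
  Subtype.val_injective.comp (descendantsEquiv ω s K).injective

theorem exists_dyadicChild_eq {I : DyadicCube d} (h : I ∈ dyadicDescendants ω s K) :
    ∃ a, dyadicChild ω s K a = I :=
  ⟨(descendantsEquiv ω s K).symm ⟨I, h⟩, by simp [dyadicChild]⟩

theorem exists_mem_dyadicChild {z : Fin d → ℝ} (hz : z ∈ dyadicCube ω K) :
    ∃ a, z ∈ dyadicCube ω (dyadicChild ω s K a) := by
  obtain ⟨a, ha⟩ := exists_dyadicChild_eq (cubeAt_mem_descendants hz s)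
  exact ⟨a, ha ▸ mem_cubeAt _ _⟩

theorem iUnion_dyadicChild :
    ⋃ a, dyadicCube ω (dyadicChild ω s K a) = dyadicCube ω K :=
  Set.Subset.antisymm (Set.iUnion_subset dyadicChild_subset) fun _ hz =>
    Set.mem_iUnion.2 (exists_mem_dyadicChild hz)

theorem dyadicChild_disjoint : Pairwise (Function.onFun Disjoint
    fun a => dyadicCube ω (dyadicChild ω s K a)) := fun a b hab =>
  dyadicCube_disjoint (by rw [dyadicChild_fst, dyadicChild_fst]) fun h =>
    hab (dyadicChild_injective h)

theorem volume_dyadicChild (a b : Fin (2 ^ (s * d))) :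
    volume (dyadicCube ω (dyadicChild ω s K a)) = volume (dyadicCube ω (dyadicChild ω s K b)) := by
  rw [volume_dyadicCube, volume_dyadicCube, dyadicChild_fst, dyadicChild_fst]

variable (ω) in
/-- The ancestor of generation `k` of a dyadic cube. -/
noncomputable def dyadicAncestor (k : ℤ) (Q : DyadicCube d) : DyadicCube d :=
  cubeAt ω k (dyadicCube_nonempty ω Q).some

theorem dyadicAncestor_eq {k : ℤ} {Q : DyadicCube d} (h : k ≤ Q.1) {z : Fin d → ℝ}
    (hz : z ∈ dyadicCube ω Q) : dyadicAncestor ω k Q = cubeAt ω k z :=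
  cubeAt_eq_of_le h ((mem_dyadicCube_iff.1 (dyadicCube_nonempty ω Q).some_mem).trans
    (mem_dyadicCube_iff.1 hz).symm)

end Children

/-! ### Averages over fibers as doubly stochastic kernels -/

section FiberKernel

variable {A : Type} [Fintype A] {B : Type*} [DecidableEq B]

/-- The kernel of the averages over the fibers of a map. -/
noncomputable def fiberKernel (π : A → B) (a a' : A) : ℝ :=
  if π a' = π a then ((Finset.univ.filter fun a'' => π a'' = π a).card : ℝ)⁻¹ else 0

theorem fiberKernel_symm (π : A → B) (a a' : A) : fiberKernel π a a' = fiberKernel π a' a := by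
  unfold fiberKernel
  by_cases h : π a' = π a
  · simp [h]
  · simp [h, Ne.symm h]

theorem isDoublyStochastic_fiberKernel (π : A → B) : IsDoublyStochastic (fiberKernel π) := by
  have hrow : ∀ a, ∑ a', fiberKernel π a a' = 1 := by
    intro a
    have h : ((Finset.univ.filter fun a'' => π a'' = π a).card : ℝ) ≠ 0 := by
      have : (Finset.univ.filter fun a'' => π a'' = π a).Nonempty := ⟨a, by simp⟩
      exact_mod_cast this.card_pos.ne'
    simp only [fiberKernel, ← Finset.sum_filter, Finset.sum_const, nsmul_eq_mul]
    exact mul_inv_cancel₀ h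
  refine ⟨fun a a' => ?_, hrow, fun a' => ?_⟩
  · unfold fiberKernel; split_ifs <;> positivity
  · simp_rw [fun a => fiberKernel_symm π a a']
    exact hrow a'

end FiberKernel

/-! ### Haar projections as differences of conditional expectations -/

section Averages

variable {d : ℕ} {ω : DyadicParam d} {E : Type*} [NormedAddCommGroup E] [NormedSpace ℝ E]
  {s : ℕ} {K : DyadicCube d}

variable (ω) in
/-- The conditional expectation `∑_I ⟨f⟩_I 1_I`, over the dyadic cubes of side length
`2 ^ (-k)`. -/
noncomputable def dyadicExp (k : ℤ) (f : (Fin d → ℝ) → E) (x : Fin d → ℝ) : E :=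
  ⨍ y in dyadicCube ω (cubeAt ω k x), f y

variable (ω) in
/-- The averages of `f` over the children of `K`. -/
noncomputable def childAverage (s : ℕ) (f : (Fin d → ℝ) → E) (K : DyadicCube d)
    (a : Fin (2 ^ (s * d))) : E :=
  ⨍ y in dyadicCube ω (dyadicChild ω s K a), f y

variable (ω) in
/-- The kernel, on the children of `K`, of the averages over the cubes `t` generations
below `K`. -/
noncomputable def ancestorKernel (s : ℕ) (K : DyadicCube d) (t : ℕ) :
    Fin (2 ^ (s * d)) → Fin (2 ^ (s * d)) → ℝ :=
  fiberKernel fun a => dyadicAncestor ω (K.1 + t) (dyadicChild ω s K a)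

theorem isDoublyStochastic_ancestorKernel (t : ℕ) :
    IsDoublyStochastic (ancestorKernel ω s K t) := isDoublyStochastic_fiberKernel _

theorem dyadicExp_of_mem {k : ℤ} {Q : DyadicCube d} (hQ : Q.1 = k) {x : Fin d → ℝ}
    (hx : x ∈ dyadicCube ω Q) (f : (Fin d → ℝ) → E) :
    dyadicExp ω k f x = ⨍ y in dyadicCube ω Q, f y := by
  subst hQ
  rw [dyadicExp, mem_dyadicCube_iff.1 hx]

/-- The children of `K` have equal volume, so the average over an intermediate cube is the uniform
mean of the averages over the children inside it. -/
theorem dyadicExp_eq_kernelMap {f : (Fin d → ℝ) → E} (hf : IntegrableOn f (dyadicCube ω K))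
    {t : ℕ} (ht : t ≤ s) {a : Fin (2 ^ (s * d))} {z : Fin d → ℝ}
    (hz : z ∈ dyadicCube ω (dyadicChild ω s K a)) :
    dyadicExp ω (K.1 + t) f z =
      kernelMap (ancestorKernel ω s K t) (fun _ _ e => e) (childAverage ω s f K) a := by
  classical
  have hle : ∀ b : Fin (2 ^ (s * d)), K.1 + t ≤ (dyadicChild ω s K b).1 := fun b => by
    rw [dyadicChild_fst]; omega
  set π := fun a => dyadicAncestor ω (K.1 + t) (dyadicChild ω s K a) with hπ
  have hQ : π a = cubeAt ω (K.1 + t) z := dyadicAncestor_eq (hle a) hz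
  set S := Finset.univ.filter fun a' => π a' = π a with hS
  have hU : dyadicCube ω (cubeAt ω (K.1 + t) z) =
      ⋃ a' ∈ S, dyadicCube ω (dyadicChild ω s K a') := by
    ext y
    simp only [Set.mem_iUnion, hS, Finset.mem_filter, Finset.mem_univ, true_and, exists_prop]
    constructor
    · intro hy
      have hyK : y ∈ dyadicCube ω K :=
        dyadicCube_subset_of_mem (by simp) (mem_cubeAt _ z) (dyadicChild_subset a hz) hy
      obtain ⟨b, hb⟩ := exists_mem_dyadicChild (s := s) hyK
      refine ⟨b, ?_, hb⟩
      rw [hQ, hπ]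
      exact (dyadicAncestor_eq (hle b) hb).trans (mem_dyadicCube_iff.1 hy)
    · rintro ⟨b, hb, hy⟩
      rw [← hQ, ← hb, hπ]
      simp only
      rw [dyadicAncestor_eq (hle b) hy]
      exact mem_cubeAt _ _
  set v := volume.real (dyadicCube ω (dyadicChild ω s K a)) with hv
  have hv0 : v ≠ 0 := (ENNReal.toReal_pos (volume_dyadicCube_ne_zero ω _)
    (volume_dyadicCube_ne_top ω _)).ne'
  have hvb : ∀ b, volume.real (dyadicCube ω (dyadicChild ω s K b)) = v := fun b => by
    rw [hv, measureReal_def, measureReal_def, volume_dyadicChild b a]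
  have hint : ∫ y in dyadicCube ω (cubeAt ω (K.1 + t) z), f y =
      ∑ b ∈ S, v • childAverage ω s f K b := by
    rw [hU, integral_biUnion_finset S (fun b _ => measurableSet_dyadicCube ω _)
      (fun b _ c _ hbc => dyadicChild_disjoint hbc) fun b _ => hf.mono_set (dyadicChild_subset b)]
    refine Finset.sum_congr rfl fun b _ => ?_
    rw [childAverage, setAverage_eq, hvb, smul_inv_smul₀ hv0]
  have hvol : volume.real (dyadicCube ω (cubeAt ω (K.1 + t) z)) = S.card * v := by
    rw [hU, measureReal_biUnion_finset (fun b _ c _ hbc => dyadicChild_disjoint hbc)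
      (fun b _ => measurableSet_dyadicCube ω _) fun b _ => volume_dyadicCube_ne_top ω _]
    simp [hvb]
  rw [dyadicExp, setAverage_eq, hint, hvol, ← Finset.smul_sum, smul_smul, mul_inv, mul_assoc,
    inv_mul_cancel₀ hv0, mul_one, kernelMap, Finset.smul_sum, hS, Finset.sum_filter]
  refine Finset.sum_congr rfl fun b _ => ?_
  simp only [ancestorKernel, fiberKernel, hπ, ite_smul, zero_smul]

theorem haarProjection_eq (I : DyadicCube d) (f : (Fin d → ℝ) → E) :
    haarProjection ω I f = (dyadicCube ω I).indicator
      fun x => dyadicExp ω (I.1 + 1) f x - dyadicExp ω I.1 f x := by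
  ext x
  have h0 : ∀ I' ∈ dyadicDescendants ω 1 I, I' ≠ cubeAt ω (I.1 + 1) x →
      dyadicAverage ω I' f x = 0 := by
    intro I' hI' hne
    refine Set.indicator_of_notMem (fun hx => hne ?_) _
    rw [mem_dyadicCube_iff, hI'.1, Nat.cast_one] at hx
    exact hx.symm
  have h1 : ∑ᶠ I' ∈ dyadicDescendants ω 1 I, dyadicAverage ω I' f x =
      ∑ᶠ _ : cubeAt ω (I.1 + 1) x ∈ dyadicDescendants ω 1 I,
        dyadicAverage ω (cubeAt ω (I.1 + 1) x) f x := by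
    refine finsum_eq_single _ _ fun I' hne => ?_
    by_cases hI' : I' ∈ dyadicDescendants ω 1 I
    · simp [hI', h0 I' hI' hne]
    · simp [hI']
  rw [haarProjection, h1]
  by_cases hx : x ∈ dyadicCube ω I
  · have h2 : cubeAt ω (I.1 + 1) x ∈ dyadicDescendants ω 1 I := by
      simpa using cubeAt_mem_descendants hx 1
    rw [Set.indicator_of_mem hx]
    simp only [h2, finsum_true, dyadicAverage, Set.indicator_of_mem hx,
      Set.indicator_of_mem (mem_cubeAt (ω := ω) (I.1 + 1) x)]
    rw [dyadicExp_of_mem rfl hx, dyadicExp]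
  · have h2 : cubeAt ω (I.1 + 1) x ∉ dyadicDescendants ω 1 I := fun h =>
      hx (h.2 (mem_cubeAt _ _))
    simp [h2, dyadicAverage, hx]

/-- Of the cubes `i` generations below `K`, only the one containing `x` contributes at `x`, so the
`finsum` collapses. -/
theorem shiftedHaarProjection_eq (i : ℕ) (K : DyadicCube d) (f : (Fin d → ℝ) → E) :
    shiftedHaarProjection ω i K f = (dyadicCube ω K).indicator
      fun x => dyadicExp ω (K.1 + (i + 1 : ℕ)) f x - dyadicExp ω (K.1 + i) f x := by
  ext x
  have h1 : ∑ᶠ I' ∈ dyadicDescendants ω i K, haarProjection ω I' f x =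
      ∑ᶠ _ : cubeAt ω (K.1 + i) x ∈ dyadicDescendants ω i K,
        haarProjection ω (cubeAt ω (K.1 + i) x) f x := by
    refine finsum_eq_single _ _ fun I' hne => ?_
    by_cases hI' : I' ∈ dyadicDescendants ω i K
    · rw [haarProjection_eq, Set.indicator_of_notMem]
      · simp
      · intro hx
        rw [mem_dyadicCube_iff, hI'.1] at hx
        exact hne hx.symm
    · simp [hI']
  rw [shiftedHaarProjection, h1]
  by_cases hx : x ∈ dyadicCube ω K
  · simp only [cubeAt_mem_descendants hx i, finsum_true, Set.indicator_of_mem hx]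
    rw [haarProjection_eq, Set.indicator_of_mem (mem_cubeAt _ _)]
    simp only [cubeAt_fst, Nat.cast_add, Nat.cast_one, add_assoc]
  · have h2 : cubeAt ω (K.1 + i) x ∉ dyadicDescendants ω i K := fun h =>
      hx (h.2 (mem_cubeAt _ _))
    simp [h2, hx]

theorem shiftedHaarProjection_of_mem_child {f : (Fin d → ℝ) → E}
    (hf : IntegrableOn f (dyadicCube ω K)) {i : ℕ} (hi : i + 1 ≤ s) {a : Fin (2 ^ (s * d))}
    {z : Fin d → ℝ} (hz : z ∈ dyadicCube ω (dyadicChild ω s K a)) :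
    shiftedHaarProjection ω i K f z =
      kernelDiff (ancestorKernel ω s K (i + 1)) (ancestorKernel ω s K i)
        (childAverage ω s f K) a := by
  rw [shiftedHaarProjection_eq, Set.indicator_of_mem (dyadicChild_subset a hz),
    dyadicExp_eq_kernelMap hf hi hz, dyadicExp_eq_kernelMap hf (by omega) hz]
  rfl

end Averages

/-! ### Operator-valued kernels and their averages over children -/

section Kernels

variable {d : ℕ} {ω : DyadicParam d} {E : Type*} [NormedAddCommGroup E] [NormedSpace ℝ E]
  {s : ℕ} {K : DyadicCube d}

theorem rademacherMoment_fin_one (q : ℝ) (e : E) :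
    rademacherMoment q (fun _ : Fin 1 => e) = ‖e‖ ^ q := by
  have h : ∀ u : ℤˣ, ‖u • e‖ = ‖e‖ := fun u => by
    rcases Int.units_eq_one_or u with rfl | rfl <;> simp
  simp [rademacherMoment, h]

theorem IsRBound.norm_apply_le {F : Type*} [NormedAddCommGroup F] [NormedSpace ℝ F] {q : ℝ}
    (hq : 1 ≤ q) {𝒯 : Set (E →L[ℝ] F)} {C : ℝ≥0} (hR : IsRBound q 𝒯 C) {T : E →L[ℝ] F}
    (hT : T ∈ 𝒯) (e : E) : ‖T e‖ ≤ C * ‖e‖ := by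
  have h := hR 1 (fun _ => T) (fun _ => e) fun _ => hT
  rw [rademacherMoment_fin_one, rademacherMoment_fin_one, one_div,
    Real.rpow_rpow_inv (norm_nonneg _) (by linarith),
    Real.rpow_rpow_inv (norm_nonneg _) (by linarith)] at h
  exact h

theorem IsRBound.rademacherMoment_le {F : Type*} [NormedAddCommGroup F] [NormedSpace ℝ F] {q : ℝ}
    (hq : 1 ≤ q) {𝒯 : Set (E →L[ℝ] F)} {C : ℝ≥0} (hR : IsRBound q 𝒯 C) {n : ℕ}
    {T : Fin n → E →L[ℝ] F} (hT : ∀ k, T k ∈ 𝒯) (e : Fin n → E) :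
    rademacherMoment q (fun k => T k (e k)) ≤ (C : ℝ) ^ q * rademacherMoment q e := by
  have h := Real.rpow_le_rpow (Real.rpow_nonneg (rademacherMoment_nonneg _) _) (hR n T e hT)
    (by linarith : (0 : ℝ) ≤ q)
  rw [Real.mul_rpow C.coe_nonneg (Real.rpow_nonneg (rademacherMoment_nonneg _) _), one_div,
    Real.rpow_inv_rpow (rademacherMoment_nonneg _) (by linarith),
    Real.rpow_inv_rpow (rademacherMoment_nonneg _) (by linarith)] at h
  exact h

/-- `R`-bounds pass to closed convex hulls. -/
theorem IsRBound.rademacherMoment_le_of_mem_closure {F : Type*} [NormedAddCommGroup F]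
    [NormedSpace ℝ F] {q : ℝ} (hq : 1 ≤ q) {𝒯 : Set (E →L[ℝ] F)} {C : ℝ≥0}
    (hR : IsRBound q 𝒯 C) {n : ℕ} (e : Fin n → E) {f : Fin n → F}
    (hf : ∀ k, f k ∈ closure (convexHull ℝ ((fun T : E →L[ℝ] F => T (e k)) '' 𝒯))) :
    rademacherMoment q f ≤ (C : ℝ) ^ q * rademacherMoment q e := by
  set V : Fin n → Set F := fun k => (fun T : E →L[ℝ] F => T (e k)) '' 𝒯
  set Z : Set (Fin n → F) := {v | rademacherMoment q v ≤ (C : ℝ) ^ q * rademacherMoment q e}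
  -- A sublevel set of a continuous convex function is closed and convex. It contains the product of
  -- the sets `V k`, hence also the closed convex hull of that product, which is the product of the
  -- closed convex hulls.
  have hZc : Convex ℝ Z := by
    simpa [Z] using (convexOn_rademacherMoment (E := F) (n := n) hq).convex_le
      ((C : ℝ) ^ q * rademacherMoment q e)
  have hZ : IsClosed Z :=
    isClosed_le (continuous_rademacherMoment (by linarith)) continuous_const
  have hV : Set.univ.pi V ⊆ Z := by
    intro v hv
    choose T hT hTv using fun k => hv k trivial
    have := hR.rademacherMoment_le hq hT e
    simp only [hTv] at this
    exact this
  have h : f ∈ closure (convexHull ℝ (Set.univ.pi V)) := by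
    rw [convexHull_pi, closure_pi_set]
    exact fun k _ => hf k
  exact closure_minimal (convexHull_min hV hZc) hZ h

variable {a : DyadicCube d → (Fin d → ℝ) → (Fin d → ℝ) → E →L[ℝ] E}

variable (ω a) in
/-- The average of the kernel `a_K(x, x') e` over `x`, `x'` in two children of `K`. -/
noncomputable def kernelAverage (s : ℕ) (K : DyadicCube d) (b b' : Fin (2 ^ (s * d))) (e : E) : E :=
  ⨍ z in dyadicCube ω (dyadicChild ω s K b) ×ˢ dyadicCube ω (dyadicChild ω s K b'), a K z.1 z.2 e

variable {q : ℝ} {R : ℝ≥0}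

theorem integrableOn_kernel (hq : 1 ≤ q) (hR : IsRBound q (kernelFamily ω a) R) {e : E}
    (ha : AEStronglyMeasurable (fun z : (Fin d → ℝ) × (Fin d → ℝ) => a K z.1 z.2 e)
        (volume.restrict (dyadicCube ω K ×ˢ dyadicCube ω K))) :
    IntegrableOn (fun z : (Fin d → ℝ) × (Fin d → ℝ) => a K z.1 z.2 e)
      (dyadicCube ω K ×ˢ dyadicCube ω K) := by
  have hm := (measurableSet_dyadicCube ω K).prod (measurableSet_dyadicCube ω K)
  have hfin : IsFiniteMeasure ((volume : Measure ((Fin d → ℝ) × (Fin d → ℝ))).restrict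
      (dyadicCube ω K ×ˢ dyadicCube ω K)) := by
    refine isFiniteMeasure_restrict.2 ?_
    rw [Measure.volume_eq_prod, Measure.prod_prod]
    exact ENNReal.mul_ne_top (volume_dyadicCube_ne_top ω K) (volume_dyadicCube_ne_top ω K)
  refine Integrable.of_bound ha (R * ‖e‖) ?_
  refine (ae_restrict_iff' hm).2 (Eventually.of_forall fun z hz => ?_)
  exact hR.norm_apply_le hq ⟨K, z.1, hz.1, z.2, hz.2, rfl⟩ e

theorem childProd_subset (b b' : Fin (2 ^ (s * d))) :
    dyadicCube ω (dyadicChild ω s K b) ×ˢ dyadicCube ω (dyadicChild ω s K b') ⊆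
      dyadicCube ω K ×ˢ dyadicCube ω K :=
  Set.prod_mono (dyadicChild_subset b) (dyadicChild_subset b')

/-- For each vector `e`, the average of `a_K(x, x') e` lies in the closed convex hull of the values
`T e`, with `T` in the family. Working vector by vector requires only strong measurability of the
kernel. -/
theorem rademacherMoment_kernelAverage_le [CompleteSpace E] (hq : 1 ≤ q)
    (hR : IsRBound q (kernelFamily ω a) R)
    (ha : ∀ (K : DyadicCube d) (e : E),
      AEStronglyMeasurable (fun z : (Fin d → ℝ) × (Fin d → ℝ) => a K z.1 z.2 e)
        (volume.restrict (dyadicCube ω K ×ˢ dyadicCube ω K)))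
    {n : ℕ} (Q : Fin n → DyadicCube d) (y z : Fin n → Fin (2 ^ (s * d))) (v : Fin n → E) :
    rademacherMoment q (fun r => kernelAverage ω a s (Q r) (y r) (z r) (v r)) ≤
      (R : ℝ) ^ q * rademacherMoment q v := by
  refine hR.rademacherMoment_le_of_mem_closure hq v fun r => ?_
  have hm := (measurableSet_dyadicCube ω (dyadicChild ω s (Q r) (y r))).prod
    (measurableSet_dyadicCube ω (dyadicChild ω s (Q r) (z r)))
  refine (convex_convexHull ℝ _).set_average_mem_closure ?_ ?_ ?_ ?_
  · rw [Measure.volume_eq_prod, Measure.prod_prod]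
    exact mul_ne_zero (volume_dyadicCube_ne_zero ω _) (volume_dyadicCube_ne_zero ω _)
  · rw [Measure.volume_eq_prod, Measure.prod_prod]
    exact ENNReal.mul_ne_top (volume_dyadicCube_ne_top ω _) (volume_dyadicCube_ne_top ω _)
  · refine (ae_restrict_iff' hm).2 (Eventually.of_forall fun x hx => ?_)
    have hx' := childProd_subset _ _ hx
    exact subset_convexHull ℝ _ ⟨a (Q r) x.1 x.2, ⟨Q r, x.1, hx'.1, x.2, hx'.2, rfl⟩, rfl⟩
  · exact (integrableOn_kernel hq hR (ha _ _)).mono_set (childProd_subset _ _)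

section AveragingOperator

variable (hq : 1 ≤ q) (hR : IsRBound q (kernelFamily ω a) R)
  (ha : ∀ e : E, AEStronglyMeasurable (fun z : (Fin d → ℝ) × (Fin d → ℝ) => a K z.1 z.2 e)
    (volume.restrict (dyadicCube ω K ×ˢ dyadicCube ω K)))
  {φ : (Fin d → ℝ) → E} {v : Fin (2 ^ (s * d)) → E}
  (hφ : ∀ b, ∀ z ∈ dyadicCube ω (dyadicChild ω s K b), φ z = v b)

include hq hR ha hφ

/-- `φ` takes one value on each child, so on each piece the integrand is the kernel applied to a
fixed vector. -/
theorem integrableOn_kernel_apply :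
    IntegrableOn (fun z : (Fin d → ℝ) × (Fin d → ℝ) => a K z.1 z.2 (φ z.2))
      (dyadicCube ω K ×ˢ dyadicCube ω K) := by
  rw [show dyadicCube ω K ×ˢ dyadicCube ω K =
    ⋃ b, dyadicCube ω K ×ˢ dyadicCube ω (dyadicChild ω s K b) by
      rw [← Set.prod_iUnion, iUnion_dyadicChild], integrableOn_finite_iUnion]
  intro b
  refine ((integrableOn_kernel hq hR (ha (v b))).mono_set
    (Set.prod_mono_right (dyadicChild_subset b))).congr_fun (fun z hz => ?_)
    ((measurableSet_dyadicCube ω _).prod (measurableSet_dyadicCube ω _))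
  simp only [hφ b z.2 hz.2]

theorem integrableOn_averagingOperator :
    IntegrableOn (averagingOperator ω K (a K) φ) (dyadicCube ω K) := by
  have h := integrableOn_kernel_apply hq hR ha hφ
  rw [IntegrableOn, Measure.volume_eq_prod, ← Measure.prod_restrict] at h
  refine IntegrableOn.congr_fun (h.integral_prod_left.smul
    (volume.real (dyadicCube ω K))⁻¹) (fun z hz => ?_) (measurableSet_dyadicCube ω K)
  rw [averagingOperator, Set.indicator_of_mem hz, setAverage_eq]
  rfl

/-- By Fubini, integrating over a child in `x` and splitting `K` into children in `x'`; equal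
volumes turn the normalization into the uniform kernel. -/
theorem childAverage_averagingOperator (b : Fin (2 ^ (s * d))) :
    childAverage ω s (averagingOperator ω K (a K) φ) K b =
      kernelMap (uniformKernel _) (kernelAverage ω a s K) v b := by
  have hI := integrableOn_kernel_apply hq hR ha hφ
  set V := volume.real (dyadicCube ω (dyadicChild ω s K b)) with hV
  have hV0 : V ≠ 0 := (ENNReal.toReal_pos (volume_dyadicCube_ne_zero ω _)
    (volume_dyadicCube_ne_top ω _)).ne'
  have hVb : ∀ c, volume.real (dyadicCube ω (dyadicChild ω s K c)) = V := fun c => by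
    rw [hV, measureReal_def, measureReal_def, volume_dyadicChild c b]
  have hVK : volume.real (dyadicCube ω K) = Fintype.card (Fin (2 ^ (s * d))) * V := by
    rw [← iUnion_dyadicChild (s := s),
      measureReal_iUnion_fintype dyadicChild_disjoint (fun c => measurableSet_dyadicCube ω _)
        fun c => volume_dyadicCube_ne_top ω _]
    simp [hVb]
  have h1 : ∫ z in dyadicCube ω (dyadicChild ω s K b), averagingOperator ω K (a K) φ z =
      (volume.real (dyadicCube ω K))⁻¹ • ∫ z in dyadicCube ω (dyadicChild ω s K b),
        ∫ z' in dyadicCube ω K, a K z z' (φ z') := by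
    rw [← integral_smul]
    refine setIntegral_congr_fun (measurableSet_dyadicCube ω _) fun z hz => ?_
    rw [averagingOperator, Set.indicator_of_mem (dyadicChild_subset b hz), setAverage_eq]
  have h2 := setIntegral_prod (μ := (volume : Measure (Fin d → ℝ)))
    (ν := (volume : Measure (Fin d → ℝ))) (f := fun z => a K z.1 z.2 (φ z.2))
    (hI.mono_set (Set.prod_mono_left (dyadicChild_subset b)))
  have h3 : ∫ z in dyadicCube ω (dyadicChild ω s K b) ×ˢ dyadicCube ω K,
      a K z.1 z.2 (φ z.2) = ∑ c, (V * V) • kernelAverage ω a s K b c (v c) := by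
    have hU : dyadicCube ω (dyadicChild ω s K b) ×ˢ dyadicCube ω K = ⋃ c,
      dyadicCube ω (dyadicChild ω s K b) ×ˢ dyadicCube ω (dyadicChild ω s K c) := by
      rw [← Set.prod_iUnion, iUnion_dyadicChild]
    rw [hU, integral_iUnion_fintype
      (fun c => (measurableSet_dyadicCube ω _).prod (measurableSet_dyadicCube ω _))
      (fun c c' hcc => Set.disjoint_prod.2 (Or.inr (dyadicChild_disjoint hcc)))
      fun c => hI.mono_set (childProd_subset _ _)]
    refine Finset.sum_congr rfl fun c _ => ?_
    have h4 : volume.real (dyadicCube ω (dyadicChild ω s K b) ×ˢ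
        dyadicCube ω (dyadicChild ω s K c)) = V * V := by
      rw [Measure.volume_eq_prod, measureReal_prod_prod, hVb, hVb]
    rw [kernelAverage, setAverage_eq, h4, smul_inv_smul₀ (mul_ne_zero hV0 hV0)]
    refine setIntegral_congr_fun
      ((measurableSet_dyadicCube ω _).prod (measurableSet_dyadicCube ω _)) fun z hz => ?_
    simp only [hφ c z.2 hz.2]
  rw [Measure.volume_eq_prod] at h3
  rw [childAverage, setAverage_eq, ← hV, h1, ← h2, h3, ← Finset.smul_sum, smul_smul, smul_smul,
    kernelMap, Finset.smul_sum, hVK]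
  refine Finset.sum_congr rfl fun c _ => ?_
  congr 1
  rw [uniformKernel, mul_inv]
  field_simp

end AveragingOperator

variable (ω a) in
/-- The value of `D^j_K A_K D^i_K f` on a child of `K`, in terms of the averages of `f` over the
children of `K`. -/
noncomputable def discreteShiftTerm (i j : ℕ) (K : DyadicCube d)
    (v : Fin (2 ^ ((max i j + 1) * d)) → E) : Fin (2 ^ ((max i j + 1) * d)) → E :=
  discreteShift (ancestorKernel ω (max i j + 1) K (j + 1)) (ancestorKernel ω (max i j + 1) K j)
    (ancestorKernel ω (max i j + 1) K (i + 1)) (ancestorKernel ω (max i j + 1) K i)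
    (kernelAverage ω a (max i j + 1) K) v

/-- `A_K D^i_K f` need not be constant on children, but `D^j_K` sees only its child averages. Depth
`max i j + 1` is what both projections need. -/
theorem dyadicShiftTerm_of_mem_child (hq : 1 ≤ q) (hR : IsRBound q (kernelFamily ω a) R)
    (ha : ∀ e : E, AEStronglyMeasurable (fun z : (Fin d → ℝ) × (Fin d → ℝ) => a K z.1 z.2 e)
      (volume.restrict (dyadicCube ω K ×ˢ dyadicCube ω K)))
    {f : (Fin d → ℝ) → E} (hf : IntegrableOn f (dyadicCube ω K)) {i j : ℕ}
    {b : Fin (2 ^ ((max i j + 1) * d))} {z : Fin d → ℝ}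
    (hz : z ∈ dyadicCube ω (dyadicChild ω (max i j + 1) K b)) :
    dyadicShiftTerm ω a i j f K z =
      discreteShiftTerm ω a i j K (childAverage ω (max i j + 1) f K) b := by
  have hφ : ∀ b, ∀ z ∈ dyadicCube ω (dyadicChild ω (max i j + 1) K b),
      shiftedHaarProjection ω i K f z = _ := fun b z hz =>
    shiftedHaarProjection_of_mem_child hf (Nat.succ_le_succ (le_max_left i j)) hz
  rw [dyadicShiftTerm, shiftedHaarProjection_of_mem_child
    (integrableOn_averagingOperator hq hR ha hφ) (Nat.succ_le_succ (le_max_right i j)) hz]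
  rw [discreteShiftTerm, discreteShift]
  congr 1
  ext c
  exact childAverage_averagingOperator hq hR ha hφ c

theorem dyadicShiftTerm_of_notMem {f : (Fin d → ℝ) → E} {i j : ℕ} {z : Fin d → ℝ}
    (hz : z ∉ dyadicCube ω K) : dyadicShiftTerm ω a i j f K z = 0 := by
  rw [dyadicShiftTerm, shiftedHaarProjection_eq, Set.indicator_of_notMem hz]

end Kernels

/-! ### Cubes as paths in a homogeneous tree -/

section Paths

variable {d : ℕ} (ω : DyadicParam d) (s : ℕ) (K : DyadicCube d) {n : ℕ}

/-- The dyadic cube reached after `r` steps along a path of children, starting from `K`. -/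
noncomputable def pathNode (x : Fin n → Fin (2 ^ (s * d))) : ℕ → DyadicCube d
  | 0 => K
  | r + 1 => if h : r < n then dyadicChild ω s (pathNode x r) (x ⟨r, h⟩) else pathNode x r

variable {ω s K} {x : Fin n → Fin (2 ^ (s * d))}

theorem pathNode_succ (r : Fin n) :
    pathNode ω s K x (r + 1) = dyadicChild ω s (pathNode ω s K x r) (x r) := by
  simp [pathNode]

theorem pathNode_fst {r : ℕ} (hr : r ≤ n) : (pathNode ω s K x r).1 = K.1 + (s * r : ℕ) := by
  induction r with
  | zero => simp [pathNode]
  | succ r ih =>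
    rw [pathNode_succ ⟨r, hr⟩, dyadicChild_fst, ih (by omega)]
    push_cast
    ring

theorem pathNode_congr {x' : Fin n → Fin (2 ^ (s * d))} {r : ℕ} (h : AgreeBefore r x x') :
    pathNode ω s K x r = pathNode ω s K x' r := by
  induction r with
  | zero => rfl
  | succ r ih =>
    have h' := ih fun l hl => h l (by omega)
    by_cases hr : r < n
    · simp only [pathNode, hr, dif_pos, h', h ⟨r, hr⟩ (Nat.lt_succ_self r)]
    · simp only [pathNode, hr, dif_neg, not_false_iff, h']

theorem pathNode_antitone : Antitone fun r => dyadicCube ω (pathNode ω s K x r) := by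
  refine antitone_nat_of_succ_le fun r => ?_
  by_cases hr : r < n
  · have := dyadicChild_subset (ω := ω) (K := pathNode ω s K x r) (x ⟨r, hr⟩)
    rwa [← pathNode_succ ⟨r, hr⟩] at this
  · simp [pathNode, hr]

theorem pathNode_eq_cubeAt {z : Fin d → ℝ} (hz : z ∈ dyadicCube ω (pathNode ω s K x n)) {r : ℕ}
    (hr : r ≤ n) : pathNode ω s K x r = cubeAt ω (K.1 + (s * r : ℕ)) z := by
  rw [← pathNode_fst (ω := ω) (x := x) hr]
  exact (mem_dyadicCube_iff.1 (pathNode_antitone hr hz)).symm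

/-- A point of the final cube determines each node of the path, and consecutive nodes determine the
step between them. -/
theorem pathNode_disjoint : Pairwise (Function.onFun Disjoint
    fun x : Fin n → Fin (2 ^ (s * d)) => dyadicCube ω (pathNode ω s K x n)) := by
  intro x x' hne
  refine Set.disjoint_left.2 fun z hz hz' => hne ?_
  ext1 r
  have h1 := pathNode_eq_cubeAt hz (r := r) (by omega)
  have h1' := pathNode_eq_cubeAt hz' (r := r) (by omega)
  have h2 := pathNode_eq_cubeAt hz (r := r + 1) (by omega)
  have h2' := pathNode_eq_cubeAt hz' (r := r + 1) (by omega)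
  refine dyadicChild_injective (ω := ω) (K := pathNode ω s K x r) ?_
  rw [← pathNode_succ, h2, ← h2', pathNode_succ, h1, h1']

variable (ω s n K) in
theorem iUnion_pathNode :
    ⋃ x : Fin n → Fin (2 ^ (s * d)), dyadicCube ω (pathNode ω s K x n) = dyadicCube ω K := by
  refine Set.Subset.antisymm (Set.iUnion_subset fun x => pathNode_antitone (Nat.zero_le n))
    fun z hz => Set.mem_iUnion.2 ?_
  have h : ∀ r : Fin n, ∃ b, z ∈ dyadicCube ω
      (dyadicChild ω s (cubeAt ω (K.1 + (s * r : ℕ)) z) b) := fun r =>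
    exists_mem_dyadicChild (mem_cubeAt _ _)
  choose x hx using h
  refine ⟨x, ?_⟩
  have h2 : ∀ r ≤ n, pathNode ω s K x r = cubeAt ω (K.1 + (s * r : ℕ)) z := by
    intro r
    induction r with
    | zero => intro _; simpa [pathNode] using (mem_dyadicCube_iff.1 hz).symm
    | succ r ih =>
      intro hr
      rw [pathNode_succ ⟨r, hr⟩, ih (by omega)]
      rw [← mem_dyadicCube_iff.1 (hx ⟨r, hr⟩), dyadicChild_fst]
      simp only [cubeAt_fst]
      congr 1
      push_cast
      ring
  rw [h2 n le_rfl]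
  exact mem_cubeAt _ _

theorem lintegral_eq_sum_pathNode (g : (Fin d → ℝ) → ℝ≥0∞) :
    ∫⁻ z in dyadicCube ω K, g z =
      ∑ x : Fin n → Fin (2 ^ (s * d)), ∫⁻ z in dyadicCube ω (pathNode ω s K x n), g z := by
  rw [← iUnion_pathNode ω s K n, lintegral_iUnion (fun x => measurableSet_dyadicCube ω _)
    pathNode_disjoint, tsum_fintype]

theorem volume_pathNode :
    volume (dyadicCube ω (pathNode ω s K x n)) =
      ENNReal.ofReal ((2 : ℝ) ^ (-(K.1 + (s * n : ℕ)))) ^ d := by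
  rw [volume_dyadicCube, pathNode_fst le_rfl]

end Paths

/-! ### The estimate on one top cube -/

section LocalEstimate

variable {d : ℕ} {ω : DyadicParam d} {E : Type*} [NormedAddCommGroup E] [NormedSpace ℝ E]
  {p : ℝ≥0∞}

/-- Jensen's inequality for averages over dyadic cubes. -/
theorem enorm_average_rpow_mul_le [CompleteSpace E] (hp1 : 1 ≤ p) (hp : p ≠ ∞)
    {f : (Fin d → ℝ) → E} (Q : DyadicCube d) (hf : IntegrableOn f (dyadicCube ω Q)) :
    ‖⨍ y in dyadicCube ω Q, f y‖ₑ ^ p.toReal * volume (dyadicCube ω Q) ≤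
      ∫⁻ y in dyadicCube ω Q, ‖f y‖ₑ ^ p.toReal := by
  have hp0 : p ≠ 0 := (zero_lt_one.trans_le hp1).ne'
  have hq : 0 < p.toReal := ENNReal.toReal_pos hp0 hp
  set V := volume (dyadicCube ω Q)
  have hV0 : V ≠ 0 := volume_dyadicCube_ne_zero ω Q
  have hVt : V ≠ ∞ := volume_dyadicCube_ne_top ω Q
  set μ : Measure (Fin d → ℝ) := V⁻¹ • volume.restrict (dyadicCube ω Q)
  have hμ : IsProbabilityMeasure μ := ⟨by simp [μ, V, ENNReal.inv_mul_cancel hV0 hVt]⟩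
  have hfm : AEStronglyMeasurable f μ := hf.aestronglyMeasurable.smul_measure _
  have h1 : ‖⨍ y in dyadicCube ω Q, f y‖ₑ ≤ eLpNorm f p μ := by
    rw [setAverage_eq']
    refine (enorm_integral_le_lintegral_enorm _).trans ?_
    rw [← eLpNorm_one_eq_lintegral_enorm]
    exact eLpNorm_le_eLpNorm_of_exponent_le hp1 hfm
  have h2 := ENNReal.rpow_le_rpow h1 hq.le
  rw [eLpNorm_eq_lintegral_rpow_enorm_toReal hp0 hp, ← ENNReal.rpow_mul,
    one_div_mul_cancel hq.ne', ENNReal.rpow_one, lintegral_smul_measure, smul_eq_mul] at h2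
  calc _ ≤ (V⁻¹ * ∫⁻ y in dyadicCube ω Q, ‖f y‖ₑ ^ p.toReal) * V := by gcongr
    _ = _ := by rw [mul_right_comm, ENNReal.inv_mul_cancel hV0 hVt, one_mul]

theorem kernelDiff_sub_const {A : Type} [Fintype A] {w₁ w₂ : A → A → ℝ}
    (h₁ : IsDoublyStochastic w₁) (h₂ : IsDoublyStochastic w₂) (v : A → E) (e : E) :
    kernelDiff w₁ w₂ (fun a => v a - e) = kernelDiff w₁ w₂ v := by
  ext a
  simp only [kernelDiff, kernelMap, smul_sub, Finset.sum_sub_distrib, ← Finset.sum_smul,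
    h₁.row_sum, h₂.row_sum]
  abel

/-- The average over `K` is the kernel average at depth `0`, and doubly stochastic averaging
preserves the sum. -/
theorem sum_childAverage_sub {f : (Fin d → ℝ) → E} {K : DyadicCube d} {s : ℕ}
    (hf : IntegrableOn f (dyadicCube ω K)) :
    ∑ b, (childAverage ω s f K b - ⨍ y in dyadicCube ω K, f y) = 0 := by
  have h : ∀ b, ⨍ y in dyadicCube ω K, f y =
      kernelMap (ancestorKernel ω s K 0) (fun _ _ e => e) (childAverage ω s f K) b := by
    intro b
    obtain ⟨z, hz⟩ := dyadicCube_nonempty ω (dyadicChild ω s K b)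
    rw [← dyadicExp_eq_kernelMap hf (Nat.zero_le s) hz,
      dyadicExp_of_mem (by simp) (dyadicChild_subset b hz)]
  rw [Finset.sum_sub_distrib, Finset.sum_congr rfl fun b _ => h b,
    sum_kernelMap (isDoublyStochastic_ancestorKernel 0), sub_self]

variable [CompleteSpace E]
  {a : DyadicCube d → (Fin d → ℝ) → (Fin d → ℝ) → E →L[ℝ] E} {R β : ℝ≥0}

theorem ofReal_sum_norm_rpow {ι : Type*} [Fintype ι] {q : ℝ} (hq : 0 ≤ q) (g : ι → E) :
    ENNReal.ofReal (∑ x, ‖g x‖ ^ q) = ∑ x, ‖g x‖ₑ ^ q := by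
  rw [ENNReal.ofReal_sum_of_nonneg fun _ _ => by positivity]
  refine Finset.sum_congr rfl fun x _ => ?_
  rw [← ofReal_norm, ENNReal.ofReal_rpow_of_nonneg (norm_nonneg _) hq]

/-- The estimate for the shift on a dyadic cube, for generations in an arithmetic progression. -/
theorem lintegral_dyadicShift_local_le (hβ : IsUMDConstant E p β) (hp1 : 1 ≤ p) (hp : p ≠ ∞)
    (hR : IsRBound p.toReal (kernelFamily ω a) R)
    (ha : ∀ (K : DyadicCube d) (e : E),
      AEStronglyMeasurable (fun z : (Fin d → ℝ) × (Fin d → ℝ) => a K z.1 z.2 e)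
        (volume.restrict (dyadicCube ω K ×ˢ dyadicCube ω K)))
    {f : (Fin d → ℝ) → E} (hf : ∀ K, IntegrableOn f (dyadicCube ω K)) (i j : ℕ)
    (P : DyadicCube d → Prop) [DecidablePred P] (K : DyadicCube d) (n : ℕ) :
    ∫⁻ z in dyadicCube ω K, ‖∑ r : Fin n,
        if P (cubeAt ω (K.1 + ((max i j + 1) * r : ℕ)) z) then
          dyadicShiftTerm ω a i j f (cubeAt ω (K.1 + ((max i j + 1) * r : ℕ)) z) z
        else 0‖ₑ ^ p.toReal ≤
      ENNReal.ofReal (4 * R * β ^ 2) ^ p.toReal *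
        ∫⁻ z in dyadicCube ω K, ‖f z‖ₑ ^ p.toReal := by
  have hp0 : p ≠ 0 := (zero_lt_one.trans_le hp1).ne'
  have hq := one_le_toReal hp1 hp
  have hq0 : 0 ≤ p.toReal := by linarith
  set s := max i j + 1 with hs
  let avg : DyadicCube d → E := fun Q => ⨍ y in dyadicCube ω Q, f y
  let B : DyadicCube d → Fin (2 ^ (s * d)) → E := fun Q b => childAverage ω s f Q b - avg Q
  let G : (Fin n → Fin (2 ^ (s * d))) → E := fun x => ∑ r : Fin n,
    if P (pathNode ω s K x r) then
      discreteShiftTerm ω a i j (pathNode ω s K x r) (B (pathNode ω s K x r)) (x r) else 0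
  have hcore : ∑ x, ‖G x‖ ^ p.toReal ≤ (4 * R * β ^ 2) ^ p.toReal *
      ∑ x : Fin n → Fin (2 ^ (s * d)),
        ‖avg K + ∑ r : Fin n, B (pathNode ω s K x r) (x r)‖ ^ p.toReal :=
    hβ.sum_norm_discreteShift_le hp1 hp (fun r x => pathNode ω s K x r)
      (fun r x x' h => pathNode_congr h) (fun Q => sum_childAverage_sub (hf Q)) P
      (w₁ := fun Q => ancestorKernel ω s Q (j + 1)) (w₂ := fun Q => ancestorKernel ω s Q j)
      (u₁ := fun Q => ancestorKernel ω s Q (i + 1)) (u₂ := fun Q => ancestorKernel ω s Q i)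
      (τ := fun Q => kernelAverage ω a s Q)
      (fun Q => isDoublyStochastic_ancestorKernel _)
      (fun Q => isDoublyStochastic_ancestorKernel _)
      (fun Q => isDoublyStochastic_ancestorKernel _)
      (fun Q => isDoublyStochastic_ancestorKernel _) R.coe_nonneg
      (fun Q y z v => rademacherMoment_kernelAverage_le hq hR ha Q y z v) (avg K)
  -- The increments telescope to the average of `f` over the final cube.
  have htel : ∀ x : Fin n → Fin (2 ^ (s * d)),
      avg K + ∑ r : Fin n, B (pathNode ω s K x r) (x r) = avg (pathNode ω s K x n) := by
    intro x
    have h1 : ∀ r : Fin n, B (pathNode ω s K x r) (x r) =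
        avg (pathNode ω s K x (r + 1)) - avg (pathNode ω s K x r) := fun r => by
      rw [pathNode_succ]; rfl
    simp_rw [h1]
    rw [Fin.sum_univ_eq_sum_range
      fun r => avg (pathNode ω s K x (r + 1)) - avg (pathNode ω s K x r),
      Finset.sum_range_sub (fun r => avg (pathNode ω s K x r))]
    simp [pathNode]
  simp_rw [htel] at hcore
  have hcoreE := ENNReal.ofReal_le_ofReal hcore
  rw [ENNReal.ofReal_mul (by positivity), ofReal_sum_norm_rpow hq0, ofReal_sum_norm_rpow hq0,
    ← ENNReal.ofReal_rpow_of_nonneg (by positivity) hq0] at hcoreE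
  set V := ENNReal.ofReal ((2 : ℝ) ^ (-(K.1 + (s * n : ℕ)))) ^ d
  have hV : ∀ x : Fin n → Fin (2 ^ (s * d)), volume (dyadicCube ω (pathNode ω s K x n)) = V :=
    fun x => volume_pathNode
  -- The shifted sum is constant on each final cube. Child averages may be replaced by increments
  -- since the differences of kernels annihilate constants.
  have hleft : ∀ x : Fin n → Fin (2 ^ (s * d)), ∫⁻ z in dyadicCube ω (pathNode ω s K x n),
      ‖∑ r : Fin n, if P (cubeAt ω (K.1 + (s * r : ℕ)) z) then
          dyadicShiftTerm ω a i j f (cubeAt ω (K.1 + (s * r : ℕ)) z) z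
        else 0‖ₑ ^ p.toReal = ‖G x‖ₑ ^ p.toReal * V := by
    intro x
    rw [← hV x, ← setLIntegral_const]
    refine setLIntegral_congr_fun (measurableSet_dyadicCube ω _) fun z hz => ?_
    simp only [G]
    congr 2
    refine Finset.sum_congr rfl fun r _ => ?_
    rw [← pathNode_eq_cubeAt hz r.2.le]
    refine if_congr Iff.rfl ?_ rfl
    have hzr : z ∈ dyadicCube ω (dyadicChild ω s (pathNode ω s K x r) (x r)) := by
      rw [← pathNode_succ]
      exact pathNode_antitone (Nat.succ_le_of_lt r.2) hz
    rw [dyadicShiftTerm_of_mem_child hq hR (ha _) (hf _) hzr]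
    simp only [discreteShiftTerm, discreteShift, B]
    rw [kernelDiff_sub_const (isDoublyStochastic_ancestorKernel _)
      (isDoublyStochastic_ancestorKernel _)]
  rw [lintegral_eq_sum_pathNode (s := s) (n := n), lintegral_eq_sum_pathNode (s := s) (n := n)]
  simp_rw [hleft]
  rw [← Finset.sum_mul]
  refine (mul_le_mul_left hcoreE V).trans ?_
  rw [mul_assoc, Finset.sum_mul]
  gcongr with x
  rw [← hV x]
  exact enorm_average_rpow_mul_le hp1 hp _ (hf _)

end LocalEstimate

/-! ### Finite sums over all cubes -/

section GlobalEstimate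

variable {d : ℕ} {ω : DyadicParam d} {E : Type*} [NormedAddCommGroup E] [NormedSpace ℝ E]
  {p : ℝ≥0∞} {a : DyadicCube d → (Fin d → ℝ) → (Fin d → ℝ) → E →L[ℝ] E} {R β : ℝ≥0}

variable (ω) in
theorem lintegral_eq_tsum_dyadicCube (k : ℤ) (g : (Fin d → ℝ) → ℝ≥0∞) :
    ∫⁻ z, g z = ∑' m : Fin d → ℤ, ∫⁻ z in dyadicCube ω (k, m), g z := by
  rw [← lintegral_iUnion (fun m => measurableSet_dyadicCube ω (k, m)) fun m m' h =>
    dyadicCube_disjoint rfl fun h' => h (Prod.ext_iff.1 h').2]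
  rw [Set.eq_univ_of_forall fun z => Set.mem_iUnion.2 ⟨dyadicIndex ω k z, mem_cubeAt k z⟩,
    Measure.restrict_univ]

theorem memLp_integrableOn_dyadicCube (hp1 : 1 ≤ p) {f : (Fin d → ℝ) → E}
    (hf : MemLp f p volume) (K : DyadicCube d) : IntegrableOn f (dyadicCube ω K) := by
  have : IsFiniteMeasure ((volume : Measure (Fin d → ℝ)).restrict (dyadicCube ω K)) :=
    isFiniteMeasure_restrict.2 (volume_dyadicCube_ne_top ω K)
  exact (hf.restrict _).integrable hp1

/-- In each generation, only the cube containing `z` can contribute at `z`. -/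
theorem sum_dyadicShiftTerm_eq {f : (Fin d → ℝ) → E} {i j : ℕ} (F : Finset (DyadicCube d))
    {k : ℤ} {s n : ℕ} (hs : 0 < s) (hF : ∀ K ∈ F, ∃ r : Fin n, K.1 = k + (s * r : ℕ))
    (z : Fin d → ℝ) [DecidablePred (· ∈ F)] :
    ∑ K ∈ F, dyadicShiftTerm ω a i j f K z =
      ∑ r : Fin n, if cubeAt ω (k + (s * r : ℕ)) z ∈ F then
          dyadicShiftTerm ω a i j f (cubeAt ω (k + (s * r : ℕ)) z) z
        else 0 := by
  classical
  have h1 : ∀ K ∈ F, dyadicShiftTerm ω a i j f K z =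
      ∑ r : Fin n, if K = cubeAt ω (k + (s * r : ℕ)) z then
        dyadicShiftTerm ω a i j f K z else 0 := by
    intro K hK
    obtain ⟨r, hr⟩ := hF K hK
    by_cases hz : z ∈ dyadicCube ω K
    · have hz' := mem_dyadicCube_iff.1 hz
      rw [Finset.sum_eq_single r, if_pos (by rw [← hr, hz'])]
      · intro t _ ht
        rw [if_neg]
        intro hKt
        have h2 : K.1 = k + (s * t : ℕ) := by rw [hKt]; rfl
        rw [hr] at h2
        have h3 : s * (r : ℕ) = s * t := by omega
        exact ht (Fin.ext (Nat.eq_of_mul_eq_mul_left hs h3).symm)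
      · simp
    · simp [dyadicShiftTerm_of_notMem hz]
  rw [Finset.sum_congr rfl h1, Finset.sum_comm]
  refine Finset.sum_congr rfl fun r _ => ?_
  rw [Finset.sum_ite_eq']
  congr

theorem eq_sum_indicator_of_disjoint {A : Type*} [Fintype A] {S : A → Set (Fin d → ℝ)}
    (hd : Pairwise (Function.onFun Disjoint S))
    {g : (Fin d → ℝ) → E} {v : A → E} (hg : ∀ b, ∀ z ∈ S b, g z = v b)
    (hg0 : ∀ z ∉ ⋃ b, S b, g z = 0) : g = ∑ b, (S b).indicator fun _ => v b := by
  ext z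
  rw [Finset.sum_apply]
  by_cases hz : z ∈ ⋃ b, S b
  · obtain ⟨b, hb⟩ := Set.mem_iUnion.1 hz
    rw [Finset.sum_eq_single b, Set.indicator_of_mem hb, hg b z hb]
    · intro c _ hc
      exact Set.indicator_of_notMem (fun h => Set.disjoint_left.1 (hd hc) h hb) _
    · simp
  · rw [hg0 z hz]
    symm
    refine Finset.sum_eq_zero fun b _ => Set.indicator_of_notMem (fun h => hz ?_) _
    exact Set.mem_iUnion.2 ⟨b, h⟩

/-- An identity at every point, which gives membership in `L^p`, linearity in `f` and independence
of the representative of `f`. -/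
theorem dyadicShiftTerm_eq_sum_indicator (hq : 1 ≤ p.toReal)
    (hR : IsRBound p.toReal (kernelFamily ω a) R)
    (ha : ∀ (K : DyadicCube d) (e : E),
      AEStronglyMeasurable (fun z : (Fin d → ℝ) × (Fin d → ℝ) => a K z.1 z.2 e)
        (volume.restrict (dyadicCube ω K ×ˢ dyadicCube ω K)))
    {f : (Fin d → ℝ) → E} {K : DyadicCube d} (hf : IntegrableOn f (dyadicCube ω K)) (i j : ℕ) :
    dyadicShiftTerm ω a i j f K = ∑ b, (dyadicCube ω (dyadicChild ω (max i j + 1) K b)).indicator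
      fun _ => discreteShiftTerm ω a i j K (childAverage ω (max i j + 1) f K) b := by
  refine eq_sum_indicator_of_disjoint dyadicChild_disjoint (fun b z hz => dyadicShiftTerm_of_mem_child hq hR (ha K) hf hz)
    fun z hz => dyadicShiftTerm_of_notMem ?_
  rwa [iUnion_dyadicChild] at hz

theorem memLp_dyadicShiftTerm (hq : 1 ≤ p.toReal)
    (hR : IsRBound p.toReal (kernelFamily ω a) R)
    (ha : ∀ (K : DyadicCube d) (e : E),
      AEStronglyMeasurable (fun z : (Fin d → ℝ) × (Fin d → ℝ) => a K z.1 z.2 e)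
        (volume.restrict (dyadicCube ω K ×ˢ dyadicCube ω K)))
    {f : (Fin d → ℝ) → E} {K : DyadicCube d} (hf : IntegrableOn f (dyadicCube ω K)) (i j : ℕ) :
    MemLp (dyadicShiftTerm ω a i j f K) p volume := by
  rw [dyadicShiftTerm_eq_sum_indicator hq hR ha hf i j]
  exact memLp_finsetSum' _ fun b _ => memLp_indicator_const p (measurableSet_dyadicCube ω _) _
    (Or.inr (volume_dyadicCube_ne_top ω _))

variable [CompleteSpace E]

/-- The cubes of the first generation `k` partition the space, so the local estimates add up. -/
theorem eLpNorm_sum_dyadicShiftTerm_progression_le (hβ : IsUMDConstant E p β) (hp1 : 1 ≤ p)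
    (hp : p ≠ ∞) (hR : IsRBound p.toReal (kernelFamily ω a) R)
    (ha : ∀ (K : DyadicCube d) (e : E),
      AEStronglyMeasurable (fun z : (Fin d → ℝ) × (Fin d → ℝ) => a K z.1 z.2 e)
        (volume.restrict (dyadicCube ω K ×ˢ dyadicCube ω K)))
    {f : (Fin d → ℝ) → E} (hf : ∀ K, IntegrableOn f (dyadicCube ω K)) (i j : ℕ)
    (F : Finset (DyadicCube d)) {k : ℤ} {n : ℕ}
    (hF : ∀ K ∈ F, ∃ r : Fin n, K.1 = k + ((max i j + 1) * r : ℕ)) :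
    eLpNorm (fun z => ∑ K ∈ F, dyadicShiftTerm ω a i j f K z) p volume ≤
      ENNReal.ofReal (4 * R * β ^ 2) * eLpNorm f p volume := by
  classical
  have hp0 : p ≠ 0 := (zero_lt_one.trans_le hp1).ne'
  have hq : 0 < p.toReal := ENNReal.toReal_pos hp0 hp
  rw [eLpNorm_eq_lintegral_rpow_enorm_toReal hp0 hp, eLpNorm_eq_lintegral_rpow_enorm_toReal hp0 hp]
  rw [← ENNReal.rpow_le_rpow_iff hq, ENNReal.mul_rpow_of_nonneg _ _ hq.le, ← ENNReal.rpow_mul,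
    ← ENNReal.rpow_mul, one_div_mul_cancel hq.ne', ENNReal.rpow_one, ENNReal.rpow_one,
    lintegral_eq_tsum_dyadicCube ω k, lintegral_eq_tsum_dyadicCube ω k, ← ENNReal.tsum_mul_left]
  refine ENNReal.tsum_le_tsum fun m => ?_
  simp_rw [sum_dyadicShiftTerm_eq F (Nat.succ_pos _) hF]
  exact lintegral_dyadicShift_local_le hβ hp1 hp hR ha hf i j (· ∈ F) (k, m) n

theorem exists_generation_eq (F : Finset (DyadicCube d)) {s : ℕ} (ρ : ℕ)
    (hF : ∀ K ∈ F, K.1 % s = ρ) :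
    ∃ (k : ℤ) (n : ℕ), ∀ K ∈ F, ∃ r : Fin n, K.1 = k + (s * r : ℕ) := by
  set t : ℕ := F.sup fun K : DyadicCube d => (K.1 / (s : ℤ)).natAbs
  -- The quotients `K.1 / s` lie in `[-t, t]`; shifted by `t` they lie in `[0, 2t]`.
  refine ⟨ρ - s * t, 2 * t + 1, fun K hK => ?_⟩
  have ht : (K.1 / s).natAbs ≤ t := Finset.le_sup (f := fun K : DyadicCube d => (K.1 / (s : ℤ)).natAbs) hK
  refine ⟨⟨(K.1 / s + t).toNat, by omega⟩, ?_⟩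
  have h1 := Int.emod_add_mul_ediv K.1 s
  rw [hF K hK] at h1
  push_cast
  rw [Int.toNat_of_nonneg (by omega)]
  linear_combination -h1

/-- Triangle inequality over the `max i j + 1` residue classes of generations. -/
theorem eLpNorm_sum_dyadicShiftTerm_le (hβ : IsUMDConstant E p β) (hp1 : 1 ≤ p)
    (hp : p ≠ ∞) (hR : IsRBound p.toReal (kernelFamily ω a) R)
    (ha : ∀ (K : DyadicCube d) (e : E),
      AEStronglyMeasurable (fun z : (Fin d → ℝ) × (Fin d → ℝ) => a K z.1 z.2 e)
        (volume.restrict (dyadicCube ω K ×ˢ dyadicCube ω K)))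
    {f : (Fin d → ℝ) → E} (hf : ∀ K, IntegrableOn f (dyadicCube ω K)) (i j : ℕ)
    (F : Finset (DyadicCube d)) :
    eLpNorm (fun z => ∑ K ∈ F, dyadicShiftTerm ω a i j f K z) p volume ≤
      ENNReal.ofReal (4 * ((max i j : ℕ) + 1) * R * β ^ 2) * eLpNorm f p volume := by
  have hq := one_le_toReal hp1 hp
  set s := max i j + 1 with hs
  let Fρ : ℕ → Finset (DyadicCube d) := fun ρ => F.filter fun K => K.1 % s = ρ
  have hsum : (fun z => ∑ K ∈ F, dyadicShiftTerm ω a i j f K z) =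
      ∑ ρ ∈ Finset.range s, fun z => ∑ K ∈ Fρ ρ, dyadicShiftTerm ω a i j f K z := by
    ext z
    rw [Finset.sum_apply]
    simp_rw [Fρ, Finset.sum_filter]
    rw [Finset.sum_comm]
    refine Finset.sum_congr rfl fun K _ => ?_
    have h1 := Int.emod_nonneg K.1 (b := (s : ℤ)) (by omega)
    have h2 := Int.emod_lt_of_pos K.1 (b := (s : ℤ)) (by omega)
    rw [Finset.sum_eq_single (K.1 % (s : ℤ)).toNat, if_pos (Int.toNat_of_nonneg h1).symm]
    · exact fun ρ _ hρ => if_neg fun h => hρ (by rw [h, Int.toNat_natCast])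
    · exact fun h => absurd (Finset.mem_range.2 (by omega)) h
  rw [hsum]
  refine (eLpNorm_sum_le (fun ρ _ => ?_) hp1).trans ?_
  · exact Finset.aestronglyMeasurable_fun_sum _ fun K _ =>
      (memLp_dyadicShiftTerm hq hR ha (hf K) i j).aestronglyMeasurable
  · have h : ∀ ρ ∈ Finset.range s,
        eLpNorm (fun z => ∑ K ∈ Fρ ρ, dyadicShiftTerm ω a i j f K z) p volume ≤
          ENNReal.ofReal (4 * R * β ^ 2) * eLpNorm f p volume := by
      intro ρ _
      obtain ⟨k, n, hkn⟩ := exists_generation_eq (Fρ ρ) (s := s) ρ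
        fun K hK => (Finset.mem_filter.1 hK).2
      exact eLpNorm_sum_dyadicShiftTerm_progression_le hβ hp1 hp hR ha hf i j _ hkn
    refine (Finset.sum_le_sum h).trans_eq ?_
    rw [Finset.sum_const, Finset.card_range, nsmul_eq_mul, ← mul_assoc]
    congr 1
    rw [← ENNReal.ofReal_natCast, ← ENNReal.ofReal_mul (by positivity), hs]
    congr 1
    push_cast
    ring

end GlobalEstimate

/-! ### Unconditional summability of families of operators -/

section Summability

variable {X ι : Type*} [NormedAddCommGroup X] [NormedSpace ℝ X] [CompleteSpace X]

/-- The vectors at which a family of operators with uniformly bounded finite partial sums is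
summable. -/
def summableSubmodule (T : ι → X →L[ℝ] X) : Submodule ℝ X where
  carrier := {f | Summable fun K => T K f}
  add_mem' hf hg := by simpa using hf.add hg
  zero_mem' := by simp
  smul_mem' c f hf := by simpa using hf.const_smul c

/-- Cauchy's criterion for `f` follows from that for a nearby `g`, since the finite sums applied to
`f - g` are uniformly small. -/
theorem isClosed_summableSubmodule {T : ι → X →L[ℝ] X} {C : ℝ}
    (hT : ∀ (F : Finset ι) f, ‖∑ K ∈ F, T K f‖ ≤ C * ‖f‖) :
    IsClosed (summableSubmodule T : Set X) := by
  classical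
  refine isClosed_of_closure_subset fun f hf => ?_
  refine summable_iff_vanishing_norm.2 fun ε hε => ?_
  obtain ⟨g, hg, hfg⟩ := Metric.mem_closure_iff.1 hf (ε / 2 / (|C| + 1)) (by positivity)
  obtain ⟨F, hF⟩ := summable_iff_vanishing_norm.1 hg (ε / 2) (by positivity)
  refine ⟨F, fun t ht => ?_⟩
  have h1 : ∑ K ∈ t, T K f = ∑ K ∈ t, T K g + ∑ K ∈ t, T K (f - g) := by
    rw [← Finset.sum_add_distrib]
    simp
  have h2 : ‖∑ K ∈ t, T K (f - g)‖ ≤ ε / 2 := by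
    refine (hT t (f - g)).trans ?_
    rw [dist_eq_norm] at hfg
    calc C * ‖f - g‖ ≤ (|C| + 1) * (ε / 2 / (|C| + 1)) := by
          refine mul_le_mul ((le_abs_self C).trans (by linarith)) hfg.le (norm_nonneg _)
            (by positivity)
      _ = ε / 2 := by field_simp
  rw [h1]
  calc _ ≤ ‖∑ K ∈ t, T K g‖ + ‖∑ K ∈ t, T K (f - g)‖ := norm_add_le _ _
    _ < ε := by linarith [hF t ht]

theorem exists_clm_hasSum {T : ι → X →L[ℝ] X} {C : ℝ}
    (hT : ∀ (F : Finset ι) f, ‖∑ K ∈ F, T K f‖ ≤ C * ‖f‖)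
    (hsum : ∀ f, Summable fun K => T K f) :
    ∃ S : X →L[ℝ] X, (∀ f, HasSum (fun K => T K f) (S f)) ∧ ∀ f, ‖S f‖ ≤ C * ‖f‖ := by
  have hbound : ∀ f, ‖∑' K, T K f‖ ≤ C * ‖f‖ := fun f =>
    le_of_tendsto (hsum f).hasSum.norm (Eventually.of_forall fun F => hT F f)
  let S : X →ₗ[ℝ] X :=
    { toFun := fun f => ∑' K, T K f
      map_add' := fun f g => by
        simp only [map_add]
        exact (hsum f).tsum_add (hsum g)
      map_smul' := fun c f => by
        simp only [map_smul, RingHom.id_apply]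
        exact (hsum f).tsum_const_smul c }
  exact ⟨S.mkContinuous C hbound, fun f => (hsum f).hasSum, hbound⟩

end Summability

/-! ### Linearity of the discrete model -/

section Linearity

variable {A : Type} [Fintype A] {E : Type*} [NormedAddCommGroup E] [NormedSpace ℝ E]

theorem kernelMap_add {w : A → A → ℝ} {τ : A → A → E → E}
    (hτ : ∀ b b' e e', τ b b' (e + e') = τ b b' e + τ b b' e') (v v' : A → E) :
    kernelMap w τ (v + v') = kernelMap w τ v + kernelMap w τ v' := by
  ext b
  simp [kernelMap, hτ, Finset.sum_add_distrib]

theorem kernelMap_smul {w : A → A → ℝ} {τ : A → A → E → E}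
    (hτ : ∀ b b' (c : ℝ) e, τ b b' (c • e) = c • τ b b' e) (c : ℝ) (v : A → E) :
    kernelMap w τ (c • v) = c • kernelMap w τ v := by
  ext b
  simp [kernelMap, hτ, Finset.smul_sum, smul_comm c]

theorem kernelDiff_add (w₁ w₂ : A → A → ℝ) (v v' : A → E) :
    kernelDiff w₁ w₂ (v + v') = kernelDiff w₁ w₂ v + kernelDiff w₁ w₂ v' := by
  ext b
  simp only [kernelDiff, kernelMap_add (τ := fun _ _ e => e) fun _ _ _ _ => rfl, Pi.add_apply]
  abel

theorem kernelDiff_smul (w₁ w₂ : A → A → ℝ) (c : ℝ) (v : A → E) :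
    kernelDiff w₁ w₂ (c • v) = c • kernelDiff w₁ w₂ v := by
  ext b
  simp only [kernelDiff, kernelMap_smul (τ := fun _ _ e => e) fun _ _ _ _ => rfl, Pi.smul_apply,
    smul_sub]

end Linearity

/-! ### The summands as bounded operators on `L^p` -/

section Operators

variable {d : ℕ} {ω : DyadicParam d} {E : Type*} [NormedAddCommGroup E] [NormedSpace ℝ E]
  {p : ℝ≥0∞} {a : DyadicCube d → (Fin d → ℝ) → (Fin d → ℝ) → E →L[ℝ] E} {R β : ℝ≥0}

variable (ω a) in
/-- The kernels of an operator-valued dyadic shift are strongly measurable. -/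
def IsShiftKernel : Prop := ∀ (K : DyadicCube d) (e : E),
  AEStronglyMeasurable (fun z : (Fin d → ℝ) × (Fin d → ℝ) => a K z.1 z.2 e)
    (volume.restrict (dyadicCube ω K ×ˢ dyadicCube ω K))

variable {q : ℝ}

theorem kernelAverage_add (hq : 1 ≤ q) (hR : IsRBound q (kernelFamily ω a) R)
    (ha : IsShiftKernel ω a) {s : ℕ} (K : DyadicCube d) (b b' : Fin (2 ^ (s * d))) (e e' : E) :
    kernelAverage ω a s K b b' (e + e') =
      kernelAverage ω a s K b b' e + kernelAverage ω a s K b b' e' := by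
  simp only [kernelAverage, setAverage_eq, map_add]
  rw [integral_add ((integrableOn_kernel hq hR (ha K e)).mono_set (childProd_subset b b'))
    ((integrableOn_kernel hq hR (ha K e')).mono_set (childProd_subset b b')), smul_add]

theorem kernelAverage_smul {s : ℕ} (K : DyadicCube d) (b b' : Fin (2 ^ (s * d))) (c : ℝ) (e : E) :
    kernelAverage ω a s K b b' (c • e) = c • kernelAverage ω a s K b b' e := by
  simp only [kernelAverage, setAverage_eq, map_smul, integral_smul, smul_comm c]

theorem discreteShiftTerm_add (hq : 1 ≤ q) (hR : IsRBound q (kernelFamily ω a) R)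
    (ha : IsShiftKernel ω a) (i j : ℕ) (K : DyadicCube d)
    (v v' : Fin (2 ^ ((max i j + 1) * d)) → E) :
    discreteShiftTerm ω a i j K (v + v') =
      discreteShiftTerm ω a i j K v + discreteShiftTerm ω a i j K v' := by
  simp only [discreteShiftTerm, discreteShift, kernelDiff_add,
    kernelMap_add (kernelAverage_add hq hR ha K)]

theorem discreteShiftTerm_smul (i j : ℕ) (K : DyadicCube d) (c : ℝ)
    (v : Fin (2 ^ ((max i j + 1) * d)) → E) :
    discreteShiftTerm ω a i j K (c • v) = c • discreteShiftTerm ω a i j K v := by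
  simp only [discreteShiftTerm, discreteShift, kernelDiff_smul,
    kernelMap_smul (kernelAverage_smul K)]

theorem childAverage_congr {f g : (Fin d → ℝ) → E} (h : f =ᵐ[volume] g) (s : ℕ)
    (K : DyadicCube d) : childAverage ω s f K = childAverage ω s g K := by
  ext b
  exact average_congr (ae_restrict_of_ae h)

theorem childAverage_add {f g : (Fin d → ℝ) → E} {K : DyadicCube d}
    (hf : IntegrableOn f (dyadicCube ω K)) (hg : IntegrableOn g (dyadicCube ω K)) (s : ℕ) :
    childAverage ω s (f + g) K = childAverage ω s f K + childAverage ω s g K := by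
  ext b
  simp only [childAverage, setAverage_eq, Pi.add_apply]
  rw [integral_add (hf.mono_set (dyadicChild_subset b)) (hg.mono_set (dyadicChild_subset b)),
    smul_add]

theorem childAverage_smul (c : ℝ) (f : (Fin d → ℝ) → E) (K : DyadicCube d) (s : ℕ) :
    childAverage ω s (c • f) K = c • childAverage ω s f K := by
  ext b
  simp only [childAverage, setAverage_eq, Pi.smul_apply, integral_smul, smul_comm c]

section

variable (hp1 : 1 ≤ p) (hp : p ≠ ∞) (hR : IsRBound p.toReal (kernelFamily ω a) R)
  (ha : IsShiftKernel ω a) (i j : ℕ) {K : DyadicCube d}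

include hp1 hp hR ha

theorem dyadicShiftTerm_congr {f g : (Fin d → ℝ) → E} (hf : IntegrableOn f (dyadicCube ω K))
    (h : f =ᵐ[volume] g) : dyadicShiftTerm ω a i j f K = dyadicShiftTerm ω a i j g K := by
  have hq := one_le_toReal hp1 hp
  rw [dyadicShiftTerm_eq_sum_indicator hq hR ha hf, dyadicShiftTerm_eq_sum_indicator hq hR ha
    (hf.congr_fun_ae (ae_restrict_of_ae h)), childAverage_congr h]

theorem dyadicShiftTerm_add {f g : (Fin d → ℝ) → E} (hf : IntegrableOn f (dyadicCube ω K))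
    (hg : IntegrableOn g (dyadicCube ω K)) :
    dyadicShiftTerm ω a i j (f + g) K =
      dyadicShiftTerm ω a i j f K + dyadicShiftTerm ω a i j g K := by
  have hq := one_le_toReal hp1 hp
  rw [dyadicShiftTerm_eq_sum_indicator hq hR ha hf, dyadicShiftTerm_eq_sum_indicator hq hR ha hg,
    dyadicShiftTerm_eq_sum_indicator hq hR ha (hf.add hg), childAverage_add hf hg,
    discreteShiftTerm_add hq hR ha, ← Finset.sum_add_distrib]
  refine Finset.sum_congr rfl fun b _ => ?_
  exact Set.indicator_add' _ _ _

theorem dyadicShiftTerm_smul (c : ℝ) {f : (Fin d → ℝ) → E}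
    (hf : IntegrableOn f (dyadicCube ω K)) :
    dyadicShiftTerm ω a i j (c • f) K = c • dyadicShiftTerm ω a i j f K := by
  have hq := one_le_toReal hp1 hp
  rw [dyadicShiftTerm_eq_sum_indicator hq hR ha hf,
    dyadicShiftTerm_eq_sum_indicator hq hR ha (hf.smul c), childAverage_smul,
    discreteShiftTerm_smul, Finset.smul_sum]
  refine Finset.sum_congr rfl fun b _ => ?_
  exact Set.indicator_const_smul _ _ _

end

variable [CompleteSpace E] [Fact (1 ≤ p)]

/-- The summands of a dyadic shift are bounded operators on `L^p`, with uniformly bounded finite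
sums. -/
theorem exists_dyadicShiftTerm_clm (hβ : IsUMDConstant E p β) (hp : p ≠ ∞)
    (hR : IsRBound p.toReal (kernelFamily ω a) R) (ha : IsShiftKernel ω a) (i j : ℕ) :
    ∃ T : DyadicCube d → Lp E p (volume : Measure (Fin d → ℝ)) →L[ℝ]
        Lp E p (volume : Measure (Fin d → ℝ)),
      (∀ K f, T K f =ᵐ[volume] dyadicShiftTerm ω a i j f K) ∧
      ∀ (F : Finset (DyadicCube d)) f,
        ‖∑ K ∈ F, T K f‖ ≤ 4 * ((max i j : ℕ) + 1) * R * β ^ 2 * ‖f‖ := by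
  have hp1 : 1 ≤ p := Fact.out
  have hq := one_le_toReal hp1 hp
  have hint : ∀ (f : Lp E p (volume : Measure (Fin d → ℝ))) (K : DyadicCube d),
      IntegrableOn f (dyadicCube ω K) := fun f K => memLp_integrableOn_dyadicCube hp1 (Lp.memLp f) K
  have hmem : ∀ (f : Lp E p (volume : Measure (Fin d → ℝ))) (K : DyadicCube d),
      MemLp (dyadicShiftTerm ω a i j f K) p volume := fun f K =>
    memLp_dyadicShiftTerm hq hR ha (hint f K) i j
  let L : DyadicCube d → Lp E p (volume : Measure (Fin d → ℝ)) →ₗ[ℝ]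
      Lp E p (volume : Measure (Fin d → ℝ)) := fun K =>
    { toFun := fun f => (hmem f K).toLp
      map_add' := fun f g => by
        rw [← MemLp.toLp_add]
        refine MemLp.toLp_congr _ _ (Eventually.of_forall fun z => ?_)
        rw [dyadicShiftTerm_congr hp1 hp hR ha i j (hint _ K) (Lp.coeFn_add f g),
          dyadicShiftTerm_add hp1 hp hR ha i j (hint f K) (hint g K)]
      map_smul' := fun c f => by
        rw [RingHom.id_apply, ← MemLp.toLp_const_smul]
        refine MemLp.toLp_congr _ _ (Eventually.of_forall fun z => ?_)
        rw [dyadicShiftTerm_congr hp1 hp hR ha i j (hint _ K) (Lp.coeFn_smul c f),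
          dyadicShiftTerm_smul hp1 hp hR ha i j c (hint f K)] }
  have hL : ∀ K f, L K f =ᵐ[volume] dyadicShiftTerm ω a i j f K := fun K f =>
    (hmem f K).coeFn_toLp
  have hbound : ∀ (F : Finset (DyadicCube d)) f,
      ‖∑ K ∈ F, L K f‖ ≤ 4 * ((max i j : ℕ) + 1) * R * β ^ 2 * ‖f‖ := by
    intro F f
    have h1 : (∑ K ∈ F, L K f : Lp E p (volume : Measure (Fin d → ℝ))) =ᵐ[volume]
        fun z => ∑ K ∈ F, dyadicShiftTerm ω a i j f K z := by
      refine (Lp.coeFn_finsetSum F fun K => L K f).trans ?_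
      have h2 : ∀ᵐ z, ∀ K : DyadicCube d, L K f z = dyadicShiftTerm ω a i j f K z :=
        ae_all_iff.2 fun K => hL K f
      filter_upwards [h2] with z hz
      rw [Finset.sum_apply]
      exact Finset.sum_congr rfl fun K _ => hz K
    rw [Lp.norm_def, Lp.norm_def, eLpNorm_congr_ae h1]
    refine (ENNReal.toReal_mono ?_
      (eLpNorm_sum_dyadicShiftTerm_le hβ hp1 hp hR ha (hint f) i j F)).trans_eq ?_
    · exact ENNReal.mul_ne_top ENNReal.ofReal_ne_top (Lp.eLpNorm_ne_top f)
    · rw [ENNReal.toReal_mul, ENNReal.toReal_ofReal (by positivity)]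
  -- Each summand is bounded by the estimate for the one-element set of cubes.
  refine ⟨fun K => (L K).mkContinuous _ fun f => by simpa using hbound {K} f, hL, hbound⟩

end Operators

/-! ### Density of step functions on dyadic cubes -/

section Density

variable {d : ℕ} (ω : DyadicParam d) {E : Type*} [NormedAddCommGroup E] [NormedSpace ℝ E]
  {p : ℝ≥0∞}

theorem dist_le_of_mem_dyadicCube {Q : DyadicCube d} {x y : Fin d → ℝ}
    (hx : x ∈ dyadicCube ω Q) (hy : y ∈ dyadicCube ω Q) : dist x y ≤ (2 : ℝ) ^ (-Q.1) := by
  refine (dist_pi_le_iff (by positivity)).2 fun c => ?_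
  have h1 := hx c
  have h2 := hy c
  rw [Real.dist_eq, abs_le]
  constructor <;> linarith [h1.1, h1.2, h2.1, h2.2]

theorem finite_dyadicIndex_image {s : Set (Fin d → ℝ)} (hs : Bornology.IsBounded s) (k : ℤ) :
    (dyadicIndex ω k '' s).Finite := by
  obtain ⟨r, hr⟩ := hs.subset_closedBall 0
  refine (Set.finite_Icc
    (fun c => ⌊(2 : ℝ) ^ k * (-r - dyadicShiftVector ω k c)⌋)
    (fun c => ⌊(2 : ℝ) ^ k * (r - dyadicShiftVector ω k c)⌋)).subset ?_
  rintro _ ⟨x, hx, rfl⟩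
  have h1 : ∀ c, |x c| ≤ r := fun c => by
    have h2 := hr hx
    rw [mem_closedBall_zero_iff] at h2
    exact (norm_le_pi_norm x c).trans h2
  have h2 : (0 : ℝ) ≤ 2 ^ k := by positivity
  refine ⟨fun c => Int.floor_le_floor (mul_le_mul_of_nonneg_left ?_ h2),
    fun c => Int.floor_le_floor (mul_le_mul_of_nonneg_left ?_ h2)⟩
  · linarith [(abs_le.1 (h1 c)).1]
  · linarith [(abs_le.1 (h1 c)).2]

theorem exists_zpow_neg_lt {δ : ℝ} (hδ : 0 < δ) : ∃ k : ℤ, (2 : ℝ) ^ (-k) < δ := by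
  obtain ⟨n, hn⟩ := exists_pow_lt_of_lt_one hδ (by norm_num : (1 / 2 : ℝ) < 1)
  refine ⟨n, ?_⟩
  rw [zpow_neg, zpow_natCast]
  simpa using hn

/-- A continuous function with compact support is uniformly close to a combination of indicators
of dyadic cubes, supported in a fixed bounded set. -/
theorem exists_sum_indicator_dist_le {g : (Fin d → ℝ) → E} (hg : Continuous g)
    (hgs : HasCompactSupport g) {η : ℝ} (hη : 0 < η) :
    ∃ (k : ℤ) (S : Finset (Fin d → ℤ)) (v : (Fin d → ℤ) → E),
      ∀ x, ‖g x - ∑ m ∈ S, (dyadicCube ω (k, m)).indicator (fun _ => v m) x‖ ≤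
        (Metric.cthickening 1 (tsupport g)).indicator (fun _ => η) x := by
  classical
  obtain ⟨δ, hδ, hgδ⟩ := Metric.uniformContinuous_iff.1
    (hg.uniformContinuous_of_tendsto_cocompact hgs.is_zero_at_infty) η hη
  -- The side length is below `δ` for uniform continuity, and below `1` so that the cubes meeting
  -- the support stay in its `1`-thickening.
  obtain ⟨k, hk⟩ := exists_zpow_neg_lt (lt_min hδ one_pos)
  have hfin := finite_dyadicIndex_image ω hgs.isCompact.isBounded k
  refine ⟨k, hfin.toFinset, fun m => g (dyadicCube_nonempty ω (k, m)).some, fun x => ?_⟩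
  have hsum : ∑ m ∈ hfin.toFinset, (dyadicCube ω (k, m)).indicator
      (fun _ => g (dyadicCube_nonempty ω (k, m)).some) x =
      if dyadicIndex ω k x ∈ hfin.toFinset then
        g (dyadicCube_nonempty ω (k, dyadicIndex ω k x)).some else 0 := by
    rw [← Finset.sum_ite_eq hfin.toFinset (dyadicIndex ω k x)
      fun m => g (dyadicCube_nonempty ω (k, m)).some]
    refine Finset.sum_congr rfl fun m _ => ?_
    rw [Set.indicator_apply]
    exact if_congr mem_dyadicCube_iff_index rfl rfl
  rw [hsum]
  by_cases hm : dyadicIndex ω k x ∈ hfin.toFinset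
  · rw [if_pos hm]
    obtain ⟨y, hy, hyx⟩ := hfin.mem_toFinset.1 hm
    have hxy : dist x y ≤ (2 : ℝ) ^ (-k) := dist_le_of_mem_dyadicCube ω (Q := (k, _))
      (mem_dyadicCube_iff_index.2 rfl) (mem_dyadicCube_iff_index.2 hyx)
    rw [Set.indicator_of_mem]
    · rw [← dist_eq_norm]
      refine (hgδ ?_).le
      exact (dist_le_of_mem_dyadicCube ω (Q := (k, _)) (mem_dyadicCube_iff_index.2 rfl)
        (dyadicCube_nonempty ω _).some_mem).trans_lt (hk.trans_le (min_le_left _ _))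
    · exact Metric.mem_cthickening_of_dist_le x y 1 _ hy
        (hxy.trans (hk.le.trans (min_le_right _ _)))
  · rw [if_neg hm]
    have hx : x ∉ tsupport g := fun hx => hm (hfin.mem_toFinset.2 ⟨x, hx, rfl⟩)
    rw [image_eq_zero_of_notMem_tsupport hx, sub_zero, norm_zero]
    exact Set.indicator_nonneg (fun _ _ => hη.le) _

theorem submodule_eq_top_of_indicator_mem [Fact (1 ≤ p)] (hp : p ≠ ∞)
    (V : Submodule ℝ (Lp E p (volume : Measure (Fin d → ℝ)))) 
    (hV : IsClosed (V : Set (Lp E p (volume : Measure (Fin d → ℝ)))))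
    (h : ∀ (Q : DyadicCube d) (e : E), indicatorConstLp p (measurableSet_dyadicCube ω Q)
      (volume_dyadicCube_ne_top ω Q) e ∈ V) : V = ⊤ := by
  have hp1 : 1 ≤ p := Fact.out
  have hp0 : p ≠ 0 := (zero_lt_one.trans_le hp1).ne'
  refine (Submodule.eq_top_iff').2 fun f => ?_
  rw [← SetLike.mem_coe, ← hV.closure_eq]
  refine Metric.mem_closure_iff.2 fun ε hε => ?_
  have hε4 : ENNReal.ofReal (ε / 4) ≠ 0 := (ENNReal.ofReal_pos.2 (by positivity)).ne'
  obtain ⟨g, hgs, hfg, hg, hgL⟩ := (Lp.memLp f).exists_hasCompactSupport_eLpNorm_sub_le hp hε4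
  set W := Metric.cthickening 1 (tsupport g)
  have hW : MeasurableSet W := Metric.isClosed_cthickening.measurableSet
  have hWt : volume W ≠ ∞ := (hgs.isCompact.isBounded.cthickening).measure_lt_top.ne
  set c := (volume W ^ (1 / p.toReal)).toReal
  have hct : volume W ^ (1 / p.toReal) ≠ ∞ := ENNReal.rpow_ne_top_of_nonneg (by positivity) hWt
  have hc : 0 ≤ c := ENNReal.toReal_nonneg
  -- A uniform error `ε / 4 / (c + 1)` on `W` has `L^p` norm at most `ε / 4`, as `c` is the `p`-th
  -- root of the volume of `W`; the `+ 1` avoids division by zero.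
  obtain ⟨k, S, v, hSv⟩ := exists_sum_indicator_dist_le ω hg hgs
    (show 0 < ε / 4 / (c + 1) by positivity)
  let u : Lp E p (volume : Measure (Fin d → ℝ)) := ∑ m ∈ S, indicatorConstLp p
    (measurableSet_dyadicCube ω (k, m)) (volume_dyadicCube_ne_top ω (k, m)) (v m)
  have hu : u =ᵐ[volume] fun x => ∑ m ∈ S, (dyadicCube ω (k, m)).indicator (fun _ => v m) x := by
    refine (Lp.coeFn_finsetSum S _).trans ?_
    have h2 : ∀ᵐ z, ∀ m : Fin d → ℤ, indicatorConstLp p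
        (measurableSet_dyadicCube ω (k, m)) (volume_dyadicCube_ne_top ω (k, m)) (v m) z =
        (dyadicCube ω (k, m)).indicator (fun _ => v m) z :=
      ae_all_iff.2 fun m => indicatorConstLp_coeFn
    filter_upwards [h2] with z hz
    rw [Finset.sum_apply]
    exact Finset.sum_congr rfl fun m _ => hz m
  have hgu : eLpNorm (g - (u : (Fin d → ℝ) → E)) p volume ≤ ENNReal.ofReal (ε / 4) := by
    have h1 : eLpNorm (g - (u : (Fin d → ℝ) → E)) p volume ≤
        eLpNorm (W.indicator fun _ => ε / 4 / (c + 1)) p volume := by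
      refine eLpNorm_mono_ae_real ?_
      filter_upwards [hu] with x hx
      rw [Pi.sub_apply, hx]
      exact hSv x
    refine h1.trans ?_
    rw [eLpNorm_indicator_const hW hp0 hp, ← ENNReal.ofReal_toReal hct,
      ← ofReal_norm, ← ENNReal.ofReal_mul (norm_nonneg _), Real.norm_of_nonneg (by positivity)]
    refine ENNReal.ofReal_le_ofReal ?_
    rw [div_mul_eq_mul_div, div_le_iff₀ (by positivity)]
    exact mul_le_mul_of_nonneg_left (by simp [c]) (by positivity)
  refine ⟨u, V.sum_mem fun m _ => h _ _, ?_⟩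
  rw [Lp.dist_def]
  have h3 : eLpNorm ((f : (Fin d → ℝ) → E) - (u : (Fin d → ℝ) → E)) p volume ≤ ENNReal.ofReal (ε / 2) := by
    have : (f : (Fin d → ℝ) → E) - (u : (Fin d → ℝ) → E) =
        ((f : (Fin d → ℝ) → E) - g) + (g - (u : (Fin d → ℝ) → E)) := by abel
    rw [this]
    refine (eLpNorm_add_le ((Lp.aestronglyMeasurable f).sub hgL.aestronglyMeasurable)
      (hgL.aestronglyMeasurable.sub (Lp.aestronglyMeasurable u)) hp1).trans ?_
    refine (add_le_add hfg hgu).trans_eq ?_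
    rw [← ENNReal.ofReal_add (by positivity) (by positivity)]
    congr 1
    ring
  calc (eLpNorm ((f : (Fin d → ℝ) → E) - (u : (Fin d → ℝ) → E)) p volume).toReal ≤ ε / 2 := ENNReal.toReal_le_of_le_ofReal (by positivity) h3
    _ < ε := by linarith

end Density

/-! ### Test functions on which the series is finite -/

section HaarFunctions

variable {d : ℕ} {ω : DyadicParam d} {E : Type*} [NormedAddCommGroup E] [NormedSpace ℝ E]

variable (ω) in
/-- The parent of a dyadic cube. -/
noncomputable def dyadicParent (Q : DyadicCube d) : DyadicCube d := dyadicAncestor ω (Q.1 - 1) Q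

theorem dyadicParent_fst (Q : DyadicCube d) : (dyadicParent ω Q).1 = Q.1 - 1 := rfl

theorem subset_dyadicParent (Q : DyadicCube d) :
    dyadicCube ω Q ⊆ dyadicCube ω (dyadicParent ω Q) :=
  dyadicCube_subset_of_mem (by simp [dyadicParent_fst]) (dyadicCube_nonempty ω Q).some_mem
    (mem_cubeAt _ _)

theorem volume_real_dyadicParent (Q : DyadicCube d) :
    volume.real (dyadicCube ω (dyadicParent ω Q)) = 2 ^ d * volume.real (dyadicCube ω Q) := by
  rw [measureReal_def, measureReal_def, volume_dyadicCube, volume_dyadicCube, dyadicParent_fst,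
    show -(Q.1 - 1) = 1 + -Q.1 by ring, zpow_add₀ two_ne_zero, zpow_one,
    ENNReal.toReal_pow, ENNReal.toReal_pow, ENNReal.toReal_ofReal (by positivity),
    ENNReal.toReal_ofReal (by positivity), mul_pow]

variable (ω) in
/-- The function `e (1_Q - 2 ^ (-d) 1_Q')`, where `Q'` is the parent of `Q`. -/
noncomputable def parentDiff (Q : DyadicCube d) (e : E) : (Fin d → ℝ) → E := fun x =>
  (dyadicCube ω Q).indicator (fun _ => e) x -
    ((2 : ℝ) ^ d)⁻¹ • (dyadicCube ω (dyadicParent ω Q)).indicator (fun _ => e) x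

theorem parentDiff_of_notMem {Q : DyadicCube d} {e : E} {x : Fin d → ℝ}
    (hx : x ∉ dyadicCube ω (dyadicParent ω Q)) : parentDiff ω Q e x = 0 := by
  rw [parentDiff, Set.indicator_of_notMem hx,
    Set.indicator_of_notMem fun h => hx (subset_dyadicParent Q h)]
  simp

theorem integrable_indicator_dyadicCube (Q : DyadicCube d) (e : E) :
    Integrable ((dyadicCube ω Q).indicator fun _ => e) :=
  (integrable_indicator_iff (measurableSet_dyadicCube ω Q)).2
    (integrableOn_const (volume_dyadicCube_ne_top ω Q))

variable [CompleteSpace E]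

theorem integral_parentDiff (Q : DyadicCube d) (e : E) :
    ∫ x in dyadicCube ω (dyadicParent ω Q), parentDiff ω Q e x = 0 := by
  have h2 : IntegrableOn (fun x => ((2 : ℝ) ^ d)⁻¹ •
      (dyadicCube ω (dyadicParent ω Q)).indicator (fun _ => e) x)
      (dyadicCube ω (dyadicParent ω Q)) :=
    ((integrable_indicator_dyadicCube _ e).smul ((2 : ℝ) ^ d)⁻¹).integrableOn
  unfold parentDiff
  rw [integral_sub (integrable_indicator_dyadicCube Q e).integrableOn h2, integral_smul,
    setIntegral_indicator (measurableSet_dyadicCube ω _),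
    setIntegral_indicator (measurableSet_dyadicCube ω _), setIntegral_const, setIntegral_const,
    Set.inter_self, Set.inter_eq_right.2 (subset_dyadicParent Q), volume_real_dyadicParent,
    smul_smul, inv_mul_cancel_left₀ (by positivity), sub_self]

theorem dyadicExp_of_const {k : ℤ} {f : (Fin d → ℝ) → E} {z : Fin d → ℝ}
    (h : ∀ y ∈ dyadicCube ω (cubeAt ω k z), f y = f z) : dyadicExp ω k f z = f z := by
  rw [dyadicExp, setAverage_congr_fun (measurableSet_dyadicCube ω _)
    (Eventually.of_forall h),
    setAverage_const (volume_dyadicCube_ne_zero ω _) (volume_dyadicCube_ne_top ω _)]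

theorem dyadicExp_parentDiff_of_le {k : ℤ} {Q : DyadicCube d} (hk : Q.1 ≤ k) (e : E)
    (z : Fin d → ℝ) : dyadicExp ω k (parentDiff ω Q e) z = parentDiff ω Q e z := by
  classical
  refine dyadicExp_of_const fun y hy => ?_
  have hyz := mem_dyadicCube_iff.1 hy
  rw [cubeAt_fst] at hyz
  have h : ∀ I : DyadicCube d, I.1 ≤ k → (y ∈ dyadicCube ω I ↔ z ∈ dyadicCube ω I) := by
    intro I hI
    rw [mem_dyadicCube_iff, mem_dyadicCube_iff, cubeAt_eq_of_le hI hyz]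
  simp only [parentDiff, Set.indicator_apply, h Q hk,
    h (dyadicParent ω Q) (by rw [dyadicParent_fst]; omega)]

/-- A cube of generation `k < Q.1` either contains the parent of `Q`, where the function has mean
zero, or is disjoint from it. -/
theorem dyadicExp_parentDiff_of_lt {k : ℤ} {Q : DyadicCube d} (hk : k < Q.1) (e : E)
    (z : Fin d → ℝ) : dyadicExp ω k (parentDiff ω Q e) z = 0 := by
  rw [dyadicExp, setAverage_eq]
  refine smul_eq_zero_of_right _ ?_
  by_cases h : ∃ y ∈ dyadicCube ω (dyadicParent ω Q), y ∈ dyadicCube ω (cubeAt ω k z)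
  · obtain ⟨y, hy, hyz⟩ := h
    have hsub := dyadicCube_subset_of_mem (by rw [cubeAt_fst, dyadicParent_fst]; omega) hy hyz
    rw [← integral_parentDiff (ω := ω) Q e]
    exact setIntegral_eq_of_subset_of_forall_sdiff_eq_zero (measurableSet_dyadicCube ω _) hsub
      fun x hx => parentDiff_of_notMem hx.2
  · push Not at h
    exact setIntegral_eq_zero_of_forall_eq_zero fun x hx =>
      parentDiff_of_notMem fun hx' => h x hx' hx

theorem dyadicShiftTerm_of_shiftedHaarProjection_eq_zero
    {a : DyadicCube d → (Fin d → ℝ) → (Fin d → ℝ) → E →L[ℝ] E} {i j : ℕ} {f : (Fin d → ℝ) → E}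
    {K : DyadicCube d} (h : shiftedHaarProjection ω i K f = 0) :
    dyadicShiftTerm ω a i j f K = 0 := by
  have h1 : averagingOperator ω K (a K) (0 : (Fin d → ℝ) → E) = 0 := by
    ext z
    simp [averagingOperator]
  rw [dyadicShiftTerm, h, h1, shiftedHaarProjection_eq]
  ext z
  simp [dyadicExp]

/-- The conditional expectations jump from `0` to the function itself between generations `Q.1 - 1`
and `Q.1`. Thus `K.1 + i = Q.1 - 1` is necessary, and `K` must meet the parent of `Q`. -/
theorem shiftedHaarProjection_parentDiff {i : ℕ} {K Q : DyadicCube d} (e : E)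
    (hK : K ≠ dyadicAncestor ω (Q.1 - 1 - i) Q) :
    shiftedHaarProjection ω i K (parentDiff ω Q e) = 0 := by
  classical
  rw [shiftedHaarProjection_eq]
  ext z
  rw [Set.indicator_apply, Pi.zero_apply]
  split_ifs with hz
  · rcases lt_trichotomy (K.1 + i) (Q.1 - 1) with h | h | h
    · rw [dyadicExp_parentDiff_of_lt (by push_cast; omega), dyadicExp_parentDiff_of_lt (by omega),
        sub_self]
    · rw [dyadicExp_parentDiff_of_le (by push_cast; omega), dyadicExp_parentDiff_of_lt (by omega),
        sub_zero]
      refine parentDiff_of_notMem fun hz' => hK ?_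
      have h1 : K.1 = Q.1 - 1 - i := by omega
      rw [← mem_dyadicCube_iff.1 hz, h1]
      refine cubeAt_eq_of_le (l := Q.1 - 1) (by omega) ?_
      exact mem_dyadicCube_iff.1 hz'
    · rw [dyadicExp_parentDiff_of_le (by push_cast; omega), dyadicExp_parentDiff_of_le (by omega),
        sub_self]
  · rfl

/-- In dimension `0` all cubes are the whole one-point space, so the conditional expectations
coincide. -/
theorem shiftedHaarProjection_of_dim_zero {ω : DyadicParam 0} (i : ℕ) (K : DyadicCube 0)
    (f : (Fin 0 → ℝ) → E) : shiftedHaarProjection ω i K f = 0 := by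
  have h : ∀ Q : DyadicCube 0, dyadicCube ω Q = Set.univ := fun Q =>
    Set.eq_univ_of_forall fun x c => c.elim0
  rw [shiftedHaarProjection_eq]
  ext z
  simp [dyadicExp, h]

end HaarFunctions

/-! ### From parent differences to all of `L^p` -/

section Main

variable {d : ℕ} {ω : DyadicParam d} {E : Type*} [NormedAddCommGroup E] [NormedSpace ℝ E]
  [CompleteSpace E] {p : ℝ≥0∞} [Fact (1 ≤ p)]

variable (ω p) in
/-- The function `1_Q e` as an element of `L^p`. -/
noncomputable def cubeIndicatorLp (Q : DyadicCube d) (e : E) :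
    Lp E p (volume : Measure (Fin d → ℝ)) :=
  indicatorConstLp p (measurableSet_dyadicCube ω Q) (volume_dyadicCube_ne_top ω Q) e

theorem cubeIndicatorLp_sub_coeFn (Q : DyadicCube d) (e : E) :
    (cubeIndicatorLp ω p Q e - ((2 : ℝ) ^ d)⁻¹ • cubeIndicatorLp ω p (dyadicParent ω Q) e :
      Lp E p (volume : Measure (Fin d → ℝ))) =ᵐ[volume] parentDiff ω Q e := by
  filter_upwards [Lp.coeFn_sub (cubeIndicatorLp ω p Q e)
      (((2 : ℝ) ^ d)⁻¹ • cubeIndicatorLp ω p (dyadicParent ω Q) e),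
    Lp.coeFn_smul ((2 : ℝ) ^ d)⁻¹ (cubeIndicatorLp ω p (dyadicParent ω Q) e),
    indicatorConstLp_coeFn (p := p) (hs := measurableSet_dyadicCube ω Q)
      (hμs := volume_dyadicCube_ne_top ω Q) (c := e),
    indicatorConstLp_coeFn (p := p) (hs := measurableSet_dyadicCube ω (dyadicParent ω Q))
      (hμs := volume_dyadicCube_ne_top ω (dyadicParent ω Q)) (c := e)] with x h1 h2 h3 h4
  rw [h1, Pi.sub_apply, h2, Pi.smul_apply]
  simp only [cubeIndicatorLp, h3, h4, parentDiff]

theorem norm_smul_cubeIndicatorLp_parent (hp1 : 1 < p) (hp : p ≠ ∞) (Q : DyadicCube d) (e : E) :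
    ‖((2 : ℝ) ^ d)⁻¹ • cubeIndicatorLp ω p (dyadicParent ω Q) e‖ =
      (((2 : ℝ) ^ d)⁻¹ * ((2 : ℝ) ^ d) ^ (1 / p.toReal)) * ‖cubeIndicatorLp ω p Q e‖ := by
  have hp0 : p ≠ 0 := (zero_lt_one.trans hp1).ne'
  rw [norm_smul, cubeIndicatorLp, cubeIndicatorLp, norm_indicatorConstLp hp0 hp,
    norm_indicatorConstLp hp0 hp, volume_real_dyadicParent,
    Real.mul_rpow (by positivity) measureReal_nonneg, Real.norm_of_nonneg (by positivity)]
  ring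

/-- A closed subspace that contains the functions `e (1_Q - 2 ^ (-d) 1_Q')` contains the functions
`e 1_Q`. -/
theorem cubeIndicatorLp_mem (hd : d ≠ 0) (hp1 : 1 < p) (hp : p ≠ ∞)
    {V : Submodule ℝ (Lp E p (volume : Measure (Fin d → ℝ)))}
    (hV : IsClosed (V : Set (Lp E p (volume : Measure (Fin d → ℝ)))))
    (h : ∀ (Q : DyadicCube d) (e : E), cubeIndicatorLp ω p Q e -
      ((2 : ℝ) ^ d)⁻¹ • cubeIndicatorLp ω p (dyadicParent ω Q) e ∈ V)
    (Q : DyadicCube d) (e : E) : cubeIndicatorLp ω p Q e ∈ V := by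
  -- The ratio `2 ^ (-d (1 - 1/p))` of the norms of consecutive `u n` below; it is less than `1`
  -- because `p > 1` and `d ≠ 0`.
  set θ : ℝ := ((2 : ℝ) ^ d)⁻¹ * ((2 : ℝ) ^ d) ^ (1 / p.toReal)
  have hθ0 : 0 ≤ θ := by positivity
  have hq : 1 < p.toReal := by
    rw [← ENNReal.toReal_one]
    exact (ENNReal.toReal_lt_toReal ENNReal.one_ne_top hp).2 hp1
  have hθ1 : θ < 1 := by
    have h1 : ((2 : ℝ) ^ d) ^ (1 / p.toReal) < 2 ^ d := by
      conv_rhs => rw [← Real.rpow_one ((2 : ℝ) ^ d)]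
      exact Real.rpow_lt_rpow_of_exponent_lt (one_lt_pow₀ one_lt_two hd)
        ((div_lt_one (by linarith)).2 hq)
    rw [inv_mul_lt_iff₀ (by positivity), mul_one]
    exact h1
  let u : ℕ → Lp E p (volume : Measure (Fin d → ℝ)) := fun n =>
    (((2 : ℝ) ^ d)⁻¹) ^ n • cubeIndicatorLp ω p ((dyadicParent ω)^[n] Q) e
  -- Telescoping: each `u n - u (n + 1)` is a multiple of a parent difference.
  have hu : ∀ n, u 0 - u n ∈ V := by
    intro n
    induction n with
    | zero => simp
    | succ n ih =>
      have h1 := V.add_mem ih (V.smul_mem ((((2 : ℝ) ^ d)⁻¹) ^ n) (h ((dyadicParent ω)^[n] Q) e))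
      rw [smul_sub, smul_smul, ← pow_succ] at h1
      simp only [u, Function.iterate_succ_apply'] at h1 ⊢
      rwa [sub_add_sub_cancel] at h1
  have hnorm : ∀ n, ‖u n‖ = θ ^ n * ‖u 0‖ := by
    intro n
    induction n with
    | zero => simp
    | succ n ih =>
      have h1 : u (n + 1) = (((2 : ℝ) ^ d)⁻¹) ^ n • (((2 : ℝ) ^ d)⁻¹ •
          cubeIndicatorLp ω p (dyadicParent ω ((dyadicParent ω)^[n] Q)) e) := by
        simp only [u, Function.iterate_succ_apply', smul_smul, pow_succ]
      rw [h1, norm_smul, norm_smul_cubeIndicatorLp_parent hp1 hp, mul_left_comm, ← norm_smul,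
        show ((2 : ℝ) ^ d)⁻¹ ^ n • cubeIndicatorLp ω p ((dyadicParent ω)^[n] Q) e = u n from rfl,
        ih, pow_succ]
      ring
  have hlim : Tendsto (fun n => u 0 - u n) atTop (nhds (u 0)) := by
    have h1 : Tendsto u atTop (nhds 0) := by
      refine tendsto_zero_iff_norm_tendsto_zero.2 ?_
      rw [funext hnorm]
      simpa using (tendsto_pow_atTop_nhds_zero_of_lt_one hθ0 hθ1).mul_const ‖u 0‖
    simpa only [sub_zero] using (tendsto_const_nhds (x := u 0)).sub h1
  have h0 : u 0 ∈ V := hV.mem_of_tendsto hlim (Eventually.of_forall hu)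
  simpa [u] using h0

end Main

theorem mainTheorem1 {E : Type*} [NormedAddCommGroup E] [NormedSpace ℝ E] [CompleteSpace E]
    (d : ℕ) (p : ℝ≥0∞) [Fact (1 ≤ p)] (hp_one : 1 < p) (hp_top : p < ∞)
    (β : ℝ≥0) (hβ : IsUMDConstant E p β)
    (ω : DyadicParam d)
    (a : DyadicCube d → (Fin d → ℝ) → (Fin d → ℝ) → E →L[ℝ] E)
    (ha : ∀ (K : DyadicCube d) (e : E),
      AEStronglyMeasurable (fun z : (Fin d → ℝ) × (Fin d → ℝ) => a K z.1 z.2 e)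
        (volume.restrict (dyadicCube ω K ×ˢ dyadicCube ω K)))
    (R : ℝ≥0) (hR : IsRBound p.toReal (kernelFamily ω a) R)
    (i j : ℕ) :
    ∃ S : Lp E p (volume : Measure (Fin d → ℝ)) →L[ℝ] Lp E p (volume : Measure (Fin d → ℝ)),
      IsDyadicShift ω a i j p S ∧
      ∀ f, ‖S f‖ ≤ 4 * ((max i j : ℕ) + 1) * R * β ^ 2 * ‖f‖ := by
  have hp := hp_top.ne
  have hq := one_le_toReal hp_one.le hp
  have hint : ∀ (f : Lp E p (volume : Measure (Fin d → ℝ))) (K : DyadicCube d),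
      IntegrableOn f (dyadicCube ω K) := fun f K =>
    memLp_integrableOn_dyadicCube hp_one.le (Lp.memLp f) K
  obtain ⟨T, hT, hTbound⟩ := exists_dyadicShiftTerm_clm hβ hp hR ha i j
  have hT0 : ∀ K (f : Lp E p (volume : Measure (Fin d → ℝ))), dyadicShiftTerm ω a i j f K = 0 → T K f = 0 := by
    intro K f h
    refine Lp.ext ((hT K f).trans ?_)
    rw [h]
    exact (Lp.coeFn_zero E p volume).symm
  have hclosed := isClosed_summableSubmodule hTbound
  have htop : summableSubmodule T = ⊤ := by
    -- The approximation by parent differences needs `d ≠ 0`; for `d = 0` every summand vanishes.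
    by_cases hd : d = 0
    · subst hd
      refine (Submodule.eq_top_iff').2 fun f => ?_
      refine summable_of_ne_finset_zero (s := ∅) fun K _ => hT0 K f ?_
      exact dyadicShiftTerm_of_shiftedHaarProjection_eq_zero
        (shiftedHaarProjection_of_dim_zero i K f)
    · refine submodule_eq_top_of_indicator_mem ω hp _ hclosed
        (cubeIndicatorLp_mem hd hp_one hp hclosed fun Q e => ?_)
      -- On a parent difference, only the ancestor of `Q` that lies `i` generations above the parent
      -- can give a nonzero summand.
      refine summable_of_ne_finset_zero (s := {dyadicAncestor ω (Q.1 - 1 - i) Q})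
        fun K hK => hT0 K _ ?_
      rw [dyadicShiftTerm_congr hp_one.le hp hR ha i j (hint _ K)
        (cubeIndicatorLp_sub_coeFn Q e)]
      exact dyadicShiftTerm_of_shiftedHaarProjection_eq_zero
        (shiftedHaarProjection_parentDiff e (by simpa using hK))
  obtain ⟨S, hS, hSbound⟩ := exists_clm_hasSum hTbound
    fun f => (Submodule.eq_top_iff'.1 htop f : f ∈ summableSubmodule T)
  refine ⟨S, fun f => ⟨fun K => memLp_dyadicShiftTerm hq hR ha (hint f K) i j, ?_⟩, hSbound⟩
  convert hS f using 2 with K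
  exact Lp.ext ((MemLp.coeFn_toLp _).trans (hT K f).symm)
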